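/- **Setting.** Let $d\ge 1$ and consider $d$ qubits with Pauli matrices $X_p,Y_p,Z_p$. For $p\in[d]$ let $m_{2p-1}=Z_1\cdots Z_{p-1}X_p$ and $m_{2p}=Z_1\cdots Z_{p-1}Y_p$ be the Majorana operators in the Jordan–Wigner encoding, and let $\rho_{2p-1}$, $\rho_{2p}$ be the pure product states $|0\rangle^{\otimes(p-1)}\otimes|+_X\rangle\otimes|0\rangle^{\otimes(d-p)}$ and $|0\rangle^{\otimes(p-1)}\otimes|+_Y\rangle\otimes|0\rangle^{\otimes(d-p)}$, where $|+_X\rangle=(|0\rangle+|1\rangle)/\sqrt2$ and $|+_Y\rangle=(|0\rangle+i|1\rangle)/\sqrt2$. An *active FLO unitary* is a unitary $V=e^{iH}$ with $H=\frac i4\sum_{j,k=1}^{2d}A_{jk}m_jm_k$, $A=-A^T\in\mathbb R^{2d\times 2d}$. For $O\in SO(2d)$ let $\Pi_{\mathrm{act}}(O)=\exp\big(\frac14\sum_{i,j}[\log O]_{ij}\,m_im_j\big)$, where $\log O$ is a real antisymmetric logarithm of $O$ (its choice affects $\Pi_{\mathrm{act}}(O)$ only up to a sign). For a unitary $V$ let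 $\Phi_V(\rho)=V\rho V^\dagger$. **Protocol.** Let $V$ be an unknown active FLO unitary on $d$ qubits. In each of $r$ independent rounds $k=1,\dots,r$, for every pair $(x,y)\in[2d]^2$, prepare $\rho_x$, evolve it by $V$, and measure $m_y$ on $V\rho_xV^\dagger$, obtaining $m^{(k)}_{yx}\in\{-1,1\}$ (all these outcomes are independent and follow the Born rule). Put $M^{(k)}=(m^{(k)}_{yx})_{y,x}$ and $\hat M_r=\frac1r\sum_{k=1}^r M^{(k)}$. Let $\hat O_r\in SO(2d)$ be an orthogonal factor of a polar decomposition $\hat M_r=\hat O_rP$ ($P$ real positive semidefinite); if $\hat M_r$ has no polar decomposition with orthogonal factor in $SO(2d)$, put $\hat O_r=I$. The estimate of $V$ is $\hat V=\Pi_{\mathrm{act}}(\hat O_r)$. **Theorem.** Let $\epsilon>0$, $\delta\in(0,1)$ and $$ r\ \ge\ \frac{28\,d^3}{\epsilon^2}\,\log\Big(\frac{4d}{\delta}\Big). $$ Then, with probability at least $1-\delta$, $\|\Phi_V-\Phi_{\hat V}\|_\Diamond\le\epsilon$. Moreover, if $\epsilon\le 2$, then with probability at least $1-\delta$ it holds simultaneously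 that $\hat M_r$ has exactly one orthogonal polar factor, that this factor lies in $SO(2d)$ (so that it equals $\hat O_r$), and that $\|\Phi_V-\Phi_{\hat V}\|_\Diamond\le\epsilon$. -/

import Mathlib

open scoped ENNReal Matrix
open MeasureTheory ProbabilityTheory

noncomputable section

namespace FLOTomography

/-! ### Qubits, Majorana operators and input states -/

/-- Labels of the computational basis of `(ℂ²)^{⊗ d}`: the bit strings of length `d`. -/
abbrev Qubits (d : ℕ) : Type := Fin d → Fin 2

/-- Labels of the `2 d` Majorana operators. The `p`-th mode (`p = 1, …, d`) carries the labels
`(p, 0)` and `(p, 1)`, which stand for the numbers `2 p - 1` and `2 p` of `[2 d]`. -/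
abbrev MajIdx (d : ℕ) : Type := Fin d × Fin 2

/-- Operators on `d` qubits, as matrices in the computational basis. -/
abbrev QOp (d : ℕ) : Type := Matrix (Qubits d) (Qubits d) ℂ

/-- Real `2 d × 2 d` matrices. -/
abbrev MajMat (d : ℕ) : Type := Matrix (MajIdx d) (MajIdx d) ℝ

def pauliX : Matrix (Fin 2) (Fin 2) ℂ := !![0, 1; 1, 0]

def pauliY : Matrix (Fin 2) (Fin 2) ℂ := !![0, -Complex.I; Complex.I, 0]

def pauliZ : Matrix (Fin 2) (Fin 2) ℂ := !![1, 0; 0, -1]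

/-- `A 1 ⊗ A 2 ⊗ ⋯ ⊗ A d`. -/
def tensorOp {d : ℕ} (A : Fin d → Matrix (Fin 2) (Fin 2) ℂ) : QOp d :=
  Matrix.of fun s t => ∏ j, A j (s j) (t j)

/-- `v 1 ⊗ v 2 ⊗ ⋯ ⊗ v d`. -/
def tensorKet {d : ℕ} (v : Fin d → Fin 2 → ℂ) : Qubits d → ℂ :=
  fun s => ∏ j, v j (s j)

/-- The Majorana operators in the Jordan-Wigner encoding:
`m_{2p-1} = Z_1 ⋯ Z_{p-1} X_p` and `m_{2p} = Z_1 ⋯ Z_{p-1} Y_p`. -/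
def majorana {d : ℕ} (y : MajIdx d) : QOp d :=
  tensorOp fun j =>
    if j < y.1 then pauliZ
    else if j = y.1 then (if y.2 = 0 then pauliX else pauliY)
    else 1

/-- The qubit state `|0⟩`. -/
def ketZero : Fin 2 → ℂ := ![1, 0]

/-- `|+_X⟩`, the eigenvector of `X` with eigenvalue `1`. -/
def ketPlusX : Fin 2 → ℂ := ![1 / (Real.sqrt 2 : ℂ), 1 / (Real.sqrt 2 : ℂ)]

/-- `|+_Y⟩`, the eigenvector of `Y` with eigenvalue `1`. -/
def ketPlusY : Fin 2 → ℂ := ![1 / (Real.sqrt 2 : ℂ), Complex.I / (Real.sqrt 2 : ℂ)]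

/-- The product states `|0⟩ ⋯ |0⟩ |+_X⟩ |0⟩ ⋯ |0⟩` and `|0⟩ ⋯ |0⟩ |+_Y⟩ |0⟩ ⋯ |0⟩`, with the
distinguished factor in position `p`, for `x = 2 p - 1` and `x = 2 p` respectively. -/
def inputKet {d : ℕ} (x : MajIdx d) : Qubits d → ℂ :=
  tensorKet fun j =>
    if j = x.1 then (if x.2 = 0 then ketPlusX else ketPlusY) else ketZero

/-- The density matrix `ρ_x` of the `x`-th input state. -/
def inputState {d : ℕ} (x : MajIdx d) : QOp d :=
  Matrix.vecMulVec (inputKet x) (star (inputKet x))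

/-! ### Active fermionic linear optics -/

/-- `∑_{i,j} A_{ij} m_i m_j`. -/
def majoranaQuad {d : ℕ} (A : MajMat d) : QOp d :=
  ∑ i, ∑ j, (A i j : ℂ) • (majorana i * majorana j)

/-- Active FLO unitaries: `V = e^{iH}` with `H = (i/4) ∑_{j,k} A_{jk} m_j m_k` for a real
antisymmetric matrix `A`. -/
def IsActiveFLO {d : ℕ} (V : QOp d) : Prop :=
  ∃ A : MajMat d, Aᵀ = -A ∧
    V = NormedSpace.exp (Complex.I • ((Complex.I / 4) • majoranaQuad A))

/-- The special orthogonal group `SO(2d)`. -/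
def SO (d : ℕ) : Set (MajMat d) :=
  {O | O ∈ Matrix.orthogonalGroup (MajIdx d) ℝ ∧ O.det = 1}

open Classical in
/-- A real antisymmetric logarithm of `O`. Every `O ∈ SO(2d)` has one; two choices lead to the
same unitary `piAct O` up to a sign. (The value is `0` for matrices without such a logarithm,
that is, outside `SO(2d)`.) -/
def soLog {d : ℕ} (O : MajMat d) : MajMat d :=
  if h : ∃ A : MajMat d, Aᵀ = -A ∧ NormedSpace.exp A = O then h.choose else 0

/-- The projective representation `Π_act(O) = exp((1/4) ∑_{i,j} [log O]_{ij} m_i m_j)`. -/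
def piAct {d : ℕ} (O : MajMat d) : QOp d :=
  NormedSpace.exp ((1 / 4 : ℂ) • majoranaQuad (soLog O))

/-! ### Unitary channels and the diamond norm -/

/-- The channel `Φ_V : ρ ↦ V ρ V†`. -/
def unitaryChannel {n : Type*} [Fintype n] (V : Matrix n n ℂ) :
    Matrix n n ℂ →ₗ[ℂ] Matrix n n ℂ where
  toFun ρ := V * ρ * Vᴴ
  map_add' ρ σ := by rw [Matrix.mul_add, Matrix.add_mul]
  map_smul' c ρ := by simp

/-- The trace norm `tr √(X† X)`, as the sum of the singular values of `X`. -/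
def traceNorm {n : Type*} [Fintype n] [DecidableEq n] (X : Matrix n n ℂ) : ℝ :=
  ∑ i, Real.sqrt ((Matrix.isHermitian_conjTranspose_mul_self X).eigenvalues i)

/-- `(Φ ⊗ id_k)(X)`: the map `Φ` acts on the blocks of `X` that are indexed by a pair of basis
vectors of the ancilla. -/
def tensorId {n k : Type*} (Φ : Matrix n n ℂ →ₗ[ℂ] Matrix n n ℂ)
    (X : Matrix (n × k) (n × k) ℂ) : Matrix (n × k) (n × k) ℂ :=
  Matrix.of fun a b => Φ (Matrix.of fun i j => X (i, a.2) (j, b.2)) a.1 b.1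

/-- The diamond norm: the supremum of `‖(Φ ⊗ id_k)(X)‖₁` over all finite-dimensional ancillas
`ℂ^k` and all `X` with `‖X‖₁ ≤ 1`. -/
def diamondNorm {n : Type*} [Fintype n] [DecidableEq n]
    (Φ : Matrix n n ℂ →ₗ[ℂ] Matrix n n ℂ) : ℝ≥0∞ :=
  ⨆ (k : ℕ) (X : Matrix (n × Fin k) (n × Fin k) ℂ) (_ : traceNorm X ≤ 1),
    ENNReal.ofReal (traceNorm (tensorId Φ X))

/-! ### The protocol -/

/-- The probability of the outcome `s ∈ {1, -1}` when the state `V ρ_x V†` is measured with the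
observable `m_y`; the spectral projection of `m_y` at `s` is `(1 + s m_y) / 2`. -/
def outcomeProb {d : ℕ} (V : QOp d) (y x : MajIdx d) (s : ℝ) : ℝ :=
  (Matrix.trace
    (((1 / 2 : ℂ) • (1 + (s : ℂ) • majorana y)) * (V * inputState x * Vᴴ))).re

/-- `m k y x` are the (random) outcomes of `r` rounds of the protocol, run on the circuit `V`:
independent `±1`-valued random variables, distributed according to the Born rule. -/
structure IsTomographyData {d r : ℕ} {Ω : Type*} [MeasurableSpace Ω] (P : Measure Ω)
    (V : QOp d) (m : Fin r → MajIdx d → MajIdx d → Ω → ℝ) : Prop where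
  measurable : ∀ k y x, Measurable (m k y x)
  outcome : ∀ k y x ω, m k y x ω = 1 ∨ m k y x ω = -1
  indep : iIndepFun (fun i : Fin r × MajIdx d × MajIdx d => m i.1 i.2.1 i.2.2) P
  born : ∀ k y x, ∀ s : ℝ, s = 1 ∨ s = -1 →
    P.real {ω | m k y x ω = s} = outcomeProb V y x s

/-- The sample average `(1/r) ∑_k M^{(k)}` of the matrices of outcomes. -/
def sampleMean {d r : ℕ} {Ω : Type*} (m : Fin r → MajIdx d → MajIdx d → Ω → ℝ) (ω : Ω) :
    MajMat d :=
  (1 / (r : ℝ)) • ∑ k, Matrix.of fun y x => m k y x ω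

/-- `Q` is an orthogonal factor in a polar decomposition `M = Q P` with `P` positive
semidefinite. -/
def IsPolarFactor {d : ℕ} (M Q : MajMat d) : Prop :=
  Q ∈ Matrix.orthogonalGroup (MajIdx d) ℝ ∧ ∃ P : MajMat d, P.PosSemidef ∧ M = Q * P

open Classical in
/-- The estimate in `SO(2d)` that is read off from `M`: an orthogonal polar factor of `M` with
determinant `1`. If there is none (`det M < 0`), the estimate is the identity. -/
def polarSO {d : ℕ} (M : MajMat d) : MajMat d :=
  if h : ∃ Q : MajMat d, Q ∈ SO d ∧ IsPolarFactor M Q then h.choose else 1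

/-- The estimator `V̂ = Π_act(Ô)` computed from the outcomes. -/
def estimator {d r : ℕ} {Ω : Type*} (m : Fin r → MajIdx d → MajIdx d → Ω → ℝ) (ω : Ω) :
    QOp d :=
  piAct (polarSO (sampleMean m ω))

end FLOTomography

end

namespace FLOTomography

/-! ### Product operators and the anticommutation relations -/

variable {d : ℕ}

/-! An active FLO unitary `V = exp(¼ ∑ B_ij m_i m_j)` rotates the Majorana operators: `V m(v) V† =
m(O v)` with `O = exp B ∈ SO(2d)` (`exp_majoranaQuad_mul_majoranaVec`). Since `tr(m_i ρ_x) = δ_ix`,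
measuring `m_y` on `V ρ_x V†` has mean `O_yx` (`outcomeProb_eq`), so the sample mean `M` is an
unbiased estimate of `O`.

Statistics: a centred sum `S` of the `r` outcomes for one entry is sub-Gaussian, hence `E
exp(S²/(4r)) ≤ √2`. By independence of the `4d²` entries, `E exp((r/4)‖M - O‖²) ≤ 4^(d²)` in
Frobenius norm (`IsTomographyData.lintegral_exp_frobSq_le`). Markov's inequality bounds the
probability of `‖M - O‖² > ε²/(7d)` by `4^(d²) exp(-rε²/(28d))`, which is at most `δ` for the given
`r`.

Geometry: when `ε ≤ 2` this threshold is below `1`, so `M` is joined to `O` by invertible matrices,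
has positive determinant and has a unique polar factor `Q`, which lies in `SO(2d)`. As `Q` is a
nearest orthogonal matrix to `M`, `‖O - Q‖ ≤ 2‖M - O‖`.

Operators: `Qᵀ O` has an antisymmetric logarithm `K` with `‖K‖ ≤ (π/2)‖O - Q‖`
(`exists_log_of_mem_orthogonalGroup`). The unitaries `V` and `Π(Q) exp(¼ ∑ K_ij m_i m_j)` rotate the
Majorana operators alike, so they differ by a phase and define one channel. The diamond distance to
`Π(Q)` is at most twice the operator distance, hence at most `½ √(2d) ‖K‖ ≤ ε`. For `ε > 2` the
closeness bound is trivial, since the diamond distance of unitary channels never exceeds `2`. -/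

theorem tensorOp_mul (A B : Fin d → Matrix (Fin 2) (Fin 2) ℂ) :
    tensorOp A * tensorOp B = tensorOp fun j => A j * B j := by
  ext s t
  simp only [tensorOp, Matrix.mul_apply, Matrix.of_apply, ← Finset.prod_mul_distrib]
  rw [Finset.prod_univ_sum, Fintype.piFinset_univ]

theorem tensorOp_one : tensorOp (fun _ : Fin d => (1 : Matrix (Fin 2) (Fin 2) ℂ)) = 1 := by
  ext s t
  simp only [tensorOp, Matrix.of_apply, Matrix.one_apply]
  split_ifs with h
  · simp [h]
  · obtain ⟨j, hj⟩ := Function.ne_iff.1 h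
    exact Finset.prod_eq_zero (Finset.mem_univ j) (by simp [hj])

theorem tensorOp_conjTranspose (A : Fin d → Matrix (Fin 2) (Fin 2) ℂ) :
    (tensorOp A)ᴴ = tensorOp fun j => (A j)ᴴ := by
  ext s t
  simp [tensorOp, Matrix.conjTranspose_apply]

theorem tensorOp_smul (c : Fin d → ℂ) (A : Fin d → Matrix (Fin 2) (Fin 2) ℂ) :
    tensorOp (fun j => c j • A j) = (∏ j, c j) • tensorOp A := by
  ext s t
  simp [tensorOp, Finset.prod_mul_distrib]

theorem tensorOp_mulVec (A : Fin d → Matrix (Fin 2) (Fin 2) ℂ) (v : Fin d → Fin 2 → ℂ) :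
    tensorOp A *ᵥ tensorKet v = tensorKet fun j => A j *ᵥ v j := by
  ext s
  simp only [tensorOp, tensorKet, Matrix.mulVec, dotProduct, Matrix.of_apply,
    ← Finset.prod_mul_distrib]
  rw [Finset.prod_univ_sum, Fintype.piFinset_univ]

theorem star_tensorKet_dotProduct (v w : Fin d → Fin 2 → ℂ) :
    star (tensorKet v) ⬝ᵥ tensorKet w = ∏ j, star (v j) ⬝ᵥ w j := by
  simp only [tensorKet, dotProduct, Pi.star_apply, star_prod, ← Finset.prod_mul_distrib]
  rw [Finset.prod_univ_sum, Fintype.piFinset_univ]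

/-- The `j`-th tensor factor of the Majorana operator `m_y`. -/
def majoranaFactor (y : MajIdx d) (j : Fin d) : Matrix (Fin 2) (Fin 2) ℂ :=
  if j < y.1 then pauliZ
  else if j = y.1 then (if y.2 = 0 then pauliX else pauliY)
  else 1

theorem majorana_eq (y : MajIdx d) : majorana y = tensorOp (majoranaFactor y) := rfl

theorem pauliX_sq : pauliX * pauliX = 1 := by
  ext i j; fin_cases i <;> fin_cases j <;> simp [pauliX, Matrix.mul_apply]

theorem pauliY_sq : pauliY * pauliY = 1 := by
  ext i j; fin_cases i <;> fin_cases j <;> simp [pauliY, Matrix.mul_apply]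

theorem pauliZ_sq : pauliZ * pauliZ = 1 := by
  ext i j; fin_cases i <;> fin_cases j <;> simp [pauliZ, Matrix.mul_apply]

theorem pauliX_mul_pauliY : pauliX * pauliY = -1 • (pauliY * pauliX) := by
  ext i j; fin_cases i <;> fin_cases j <;> simp [pauliX, pauliY, Matrix.mul_apply]

theorem pauliX_mul_pauliZ : pauliX * pauliZ = -1 • (pauliZ * pauliX) := by
  ext i j; fin_cases i <;> fin_cases j <;> simp [pauliX, pauliZ, Matrix.mul_apply]

theorem pauliY_mul_pauliZ : pauliY * pauliZ = -1 • (pauliZ * pauliY) := by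
  ext i j; fin_cases i <;> fin_cases j <;> simp [pauliY, pauliZ, Matrix.mul_apply]

theorem pauliX_conjTranspose : pauliXᴴ = pauliX := by
  ext i j; fin_cases i <;> fin_cases j <;> simp [pauliX]

theorem pauliY_conjTranspose : pauliYᴴ = pauliY := by
  ext i j; fin_cases i <;> fin_cases j <;> simp [pauliY]

theorem pauliZ_conjTranspose : pauliZᴴ = pauliZ := by
  ext i j; fin_cases i <;> fin_cases j <;> simp [pauliZ]

theorem majoranaFactor_sq (y : MajIdx d) (j : Fin d) :
    majoranaFactor y j * majoranaFactor y j = 1 := by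
  unfold majoranaFactor
  split_ifs <;> simp [pauliX_sq, pauliY_sq, pauliZ_sq]

theorem majoranaFactor_conjTranspose (y : MajIdx d) (j : Fin d) :
    (majoranaFactor y j)ᴴ = majoranaFactor y j := by
  unfold majoranaFactor
  split_ifs <;> simp [pauliX_conjTranspose, pauliY_conjTranspose, pauliZ_conjTranspose]

theorem majorana_sq (y : MajIdx d) : majorana y * majorana y = 1 := by
  rw [majorana_eq, tensorOp_mul]
  simp only [majoranaFactor_sq, tensorOp_one]

theorem majorana_conjTranspose (y : MajIdx d) : (majorana y)ᴴ = majorana y := by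
  rw [majorana_eq, tensorOp_conjTranspose]
  simp only [majoranaFactor_conjTranspose]

/-- Only at the site of `x` does `X` or `Y` meet the `Z` of the other string; elsewhere the factors
commute. -/
theorem majoranaFactor_mul_of_lt {x y : MajIdx d} (h : x.1 < y.1) (j : Fin d) :
    majoranaFactor x j * majoranaFactor y j =
      (if j = x.1 then (-1 : ℂ) else 1) • (majoranaFactor y j * majoranaFactor x j) := by
  unfold majoranaFactor
  rcases lt_trichotomy j x.1 with hj | hj | hj
  · simp [hj, hj.trans h, hj.ne]
  · subst hj
    by_cases hx : x.2 = 0 <;> simp [h, hx, pauliX_mul_pauliZ, pauliY_mul_pauliZ]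
  · simp [hj.not_gt, hj.ne']

theorem majoranaFactor_mul_same (p : Fin d) (j : Fin d) :
    majoranaFactor (p, 0) j * majoranaFactor (p, 1) j =
      (if j = p then (-1 : ℂ) else 1) • (majoranaFactor (p, 1) j * majoranaFactor (p, 0) j) := by
  unfold majoranaFactor
  rcases lt_trichotomy j p with hj | hj | hj
  · simp [hj, hj.ne]
  · subst hj
    simp [pauliX_mul_pauliY]
  · simp [hj.not_gt, hj.ne']

/-- A single anticommuting tensor factor gives the whole product the sign `-1`. -/
theorem majorana_anticomm_aux {x y : MajIdx d} (p : Fin d)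
    (h : ∀ j, majoranaFactor x j * majoranaFactor y j =
      (if j = p then (-1 : ℂ) else 1) • (majoranaFactor y j * majoranaFactor x j)) :
    majorana x * majorana y = -(majorana y * majorana x) := by
  simp only [majorana_eq, tensorOp_mul, h]
  rw [tensorOp_smul]
  simp

theorem majorana_mul_of_ne {x y : MajIdx d} (h : x ≠ y) :
    majorana x * majorana y = -(majorana y * majorana x) := by
  rcases lt_trichotomy x.1 y.1 with hxy | hxy | hxy
  · exact majorana_anticomm_aux _ (majoranaFactor_mul_of_lt hxy)
  · obtain ⟨p, a⟩ := x
    obtain ⟨q, b⟩ := y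
    obtain rfl : p = q := hxy
    have hs := majorana_anticomm_aux _ (majoranaFactor_mul_same p)
    fin_cases a <;> fin_cases b
    · exact absurd rfl h
    · exact hs
    · exact (neg_eq_iff_eq_neg.2 hs).symm
    · exact absurd rfl h
  · exact (neg_eq_iff_eq_neg.2 (majorana_anticomm_aux _ (majoranaFactor_mul_of_lt hxy))).symm

/-- The canonical anticommutation relations. -/
theorem majorana_anticomm (x y : MajIdx d) :
    majorana x * majorana y + majorana y * majorana x = if x = y then 2 else 0 := by
  split_ifs with h
  · rw [h, majorana_sq, one_add_one_eq_two]
  · rw [majorana_mul_of_ne h, neg_add_cancel]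

/-- The Majorana operator `∑ i, v i m_i` of a real vector `v`. -/
noncomputable def majoranaVec (v : MajIdx d → ℝ) : QOp d := ∑ i, (v i : ℂ) • majorana i

theorem majoranaVec_add (v w : MajIdx d → ℝ) :
    majoranaVec (v + w) = majoranaVec v + majoranaVec w := by
  simp [majoranaVec, add_smul, Finset.sum_add_distrib]

theorem majoranaVec_smul (c : ℝ) (v : MajIdx d → ℝ) :
    majoranaVec (c • v) = c • majoranaVec v := by
  simp only [majoranaVec, Pi.smul_apply, smul_eq_mul, Complex.ofReal_mul, mul_smul,
    Finset.smul_sum, Complex.coe_smul]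

theorem majoranaVec_single (i : MajIdx d) : majoranaVec (Pi.single i 1) = majorana i := by
  rw [majoranaVec, Finset.sum_eq_single i] <;> simp +contextual

theorem majoranaVec_conjTranspose (v : MajIdx d → ℝ) : (majoranaVec v)ᴴ = majoranaVec v := by
  simp [majoranaVec, Matrix.conjTranspose_sum, majorana_conjTranspose]

theorem majoranaVec_sq (v : MajIdx d → ℝ) :
    majoranaVec v * majoranaVec v = (((∑ i, v i ^ 2 : ℝ)) : ℂ) • 1 := by
  -- Twice the square, with the indices swapped in one copy, is a sum of anticommutators, of which
  -- only the diagonal ones survive.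
  have h2 : majoranaVec v * majoranaVec v + majoranaVec v * majoranaVec v
      = (2 * ((∑ i, v i ^ 2 : ℝ) : ℂ)) • (1 : QOp d) := by
    have e1 : majoranaVec v * majoranaVec v
        = ∑ i, ∑ j, ((v i * v j : ℝ) : ℂ) • (majorana i * majorana j) := by
      simp only [majoranaVec, Finset.sum_mul_sum, smul_mul_smul_comm, Complex.ofReal_mul]
    have e2 : majoranaVec v * majoranaVec v
        = ∑ i, ∑ j, ((v i * v j : ℝ) : ℂ) • (majorana j * majorana i) := by
      rw [e1, Finset.sum_comm]
      simp only [mul_comm (v _) (v _)]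
    conv_lhs => enter [1]; rw [e1]
    rw [e2]
    simp only [← Finset.sum_add_distrib, ← smul_add, majorana_anticomm]
    simp only [smul_ite, smul_zero, Finset.sum_ite_eq, Finset.mem_univ, if_true]
    rw [← Finset.sum_smul, ← Complex.ofReal_sum]
    simp only [← pow_two]
    rw [mul_comm, mul_smul]
    congr 1
    rw [← Algebra.algebraMap_eq_smul_one, map_ofNat]
  rw [← two_smul ℂ, mul_smul] at h2
  exact smul_right_injective _ (two_ne_zero) h2

/-! ### Quadratic Majorana operators and their adjoint action -/

theorem majoranaQuad_eq (A : MajMat d) :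
    majoranaQuad A = ∑ i, majorana i * majoranaVec (A i) := by
  simp [majoranaQuad, majoranaVec, Finset.mul_sum]

theorem majoranaQuad_neg (A : MajMat d) : majoranaQuad (-A) = -majoranaQuad A := by
  simp [majoranaQuad]

theorem majoranaQuad_conjTranspose (A : MajMat d) :
    (majoranaQuad A)ᴴ = majoranaQuad Aᵀ := by
  simp only [majoranaQuad, Matrix.conjTranspose_sum, Matrix.conjTranspose_smul,
    Matrix.conjTranspose_mul, majorana_conjTranspose, Matrix.transpose_apply]
  rw [Finset.sum_comm]
  simp

/-- This is the identity `[ab, c] = a{b, c} - {a, c}b` combined with the anticommutation relations.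
-/
theorem majorana_mul_mul_comm_sub (i j k : MajIdx d) :
    majorana i * majorana j * majorana k - majorana k * (majorana i * majorana j)
      = (if j = k then (2 : ℂ) else 0) • majorana i - (if i = k then (2 : ℂ) else 0) • majorana j := by
  have h1 := majorana_anticomm j k
  have h2 := majorana_anticomm i k
  have e : ∀ x y : MajIdx d, (if x = y then (2 : QOp d) else 0)
      = (if x = y then (2 : ℂ) else 0) • 1 := by
    intro x y
    split_ifs
    · rw [← Algebra.algebraMap_eq_smul_one, map_ofNat]
    · simp
  rw [e] at h1 h2
  have a1 : majorana i * (majorana j * majorana k + majorana k * majorana j)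
      = (if j = k then (2 : ℂ) else 0) • majorana i := by rw [h1]; simp
  have a2 : (majorana i * majorana k + majorana k * majorana i) * majorana j
      = (if i = k then (2 : ℂ) else 0) • majorana j := by rw [h2]; simp
  rw [← a1, ← a2]
  noncomm_ring

/-- The adjoint action of a quadratic Majorana operator on the linear ones. -/
theorem majoranaQuad_commutator {A : MajMat d} (hA : Aᵀ = -A) (v : MajIdx d → ℝ) :
    ((1 / 4 : ℂ) • majoranaQuad A) * majoranaVec v - majoranaVec v * ((1 / 4 : ℂ) • majoranaQuad A)
      = majoranaVec (A *ᵥ v) := by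
  have hA' : ∀ i j, A j i = - A i j := fun i j => congr_fun (congr_fun hA i) j
  have key : ∀ k, majoranaQuad A * majorana k - majorana k * majoranaQuad A
      = (4 : ℂ) • ∑ i, (A i k : ℂ) • majorana i := by
    intro k
    simp only [majoranaQuad, Finset.sum_mul, Finset.mul_sum, ← Finset.sum_sub_distrib,
      smul_mul_assoc, mul_smul_comm, ← smul_sub, majorana_mul_mul_comm_sub]
    -- The two sums contribute `2 A i k` and `-2 A k i`, which are equal by antisymmetry; the
    -- resulting `4` cancels the prefactor `1/4`.
    have s1 : ∑ i, ∑ j, (A i j : ℂ) • (if j = k then (2 : ℂ) else 0) • majorana i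
        = ∑ i, (2 * A i k : ℂ) • majorana i := by
      refine Finset.sum_congr rfl fun i _ => ?_
      rw [Finset.sum_eq_single k]
      · rw [if_pos rfl, smul_smul, mul_comm]
      · intro j _ hj
        rw [if_neg hj, zero_smul, smul_zero]
      · simp
    have s2 : ∑ i, ∑ j, (A i j : ℂ) • (if i = k then (2 : ℂ) else 0) • majorana j
        = ∑ j, (2 * A k j : ℂ) • majorana j := by
      rw [Finset.sum_eq_single k]
      · simp only [if_true, smul_smul, mul_comm]
      · intro i _ hi
        simp [hi]
      · simp
    simp only [smul_sub, Finset.sum_sub_distrib, s1, s2]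
    rw [← Finset.sum_sub_distrib, Finset.smul_sum]
    refine Finset.sum_congr rfl fun i _ => ?_
    rw [hA' i k, smul_smul, ← sub_smul]
    congr 1
    push_cast
    ring
  have e : majoranaQuad A * majoranaVec v - majoranaVec v * majoranaQuad A
      = ∑ k, (v k : ℂ) • (majoranaQuad A * majorana k - majorana k * majoranaQuad A) := by
    simp only [majoranaVec, Finset.mul_sum, Finset.sum_mul, smul_sub, Finset.sum_sub_distrib,
      smul_mul_assoc, mul_smul_comm]
  rw [smul_mul_assoc, mul_smul_comm, ← smul_sub, e]
  simp only [key, majoranaVec, Matrix.mulVec, dotProduct, Complex.ofReal_sum, Finset.sum_smul,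
    Finset.smul_sum, smul_smul]
  rw [Finset.sum_comm]
  refine Finset.sum_congr rfl fun i _ => Finset.sum_congr rfl fun k _ => ?_
  congr 1
  push_cast
  ring

/-! ### Input states -/

theorem trace_mul_inputState (T : QOp d) (x : MajIdx d) :
    Matrix.trace (T * inputState x) = star (inputKet x) ⬝ᵥ (T *ᵥ inputKet x) := by
  rw [inputState, Matrix.mul_vecMulVec, Matrix.trace_vecMulVec, dotProduct_comm]

/-- The `j`-th tensor factor of the `x`-th input vector. -/
noncomputable def inputFactor (x : MajIdx d) (j : Fin d) : Fin 2 → ℂ :=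
  if j = x.1 then (if x.2 = 0 then ketPlusX else ketPlusY) else ketZero

theorem inputKet_eq (x : MajIdx d) : inputKet x = tensorKet (inputFactor x) := rfl

theorem inv_sqrt_two_mul_self : ((Real.sqrt 2 : ℂ))⁻¹ * ((Real.sqrt 2 : ℂ))⁻¹ = 1 / 2 := by
  rw [← mul_inv, ← Complex.ofReal_mul, Real.mul_self_sqrt (by norm_num)]
  norm_num

theorem star_inputFactor_dotProduct_self (x : MajIdx d) (j : Fin d) :
    star (inputFactor x j) ⬝ᵥ inputFactor x j = 1 := by
  have h := inv_sqrt_two_mul_self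
  have h' := Complex.I_mul_I
  unfold inputFactor
  split_ifs
  · simp [ketPlusX, dotProduct, h]; norm_num
  · simp [ketPlusY, dotProduct]
    linear_combination (2 : ℂ) * h - h' * ((Real.sqrt 2 : ℂ))⁻¹ * ((Real.sqrt 2 : ℂ))⁻¹
  · simp [ketZero, dotProduct]

theorem trace_inputState (x : MajIdx d) : Matrix.trace (inputState x) = 1 := by
  have := trace_mul_inputState 1 x
  rw [one_mul, Matrix.one_mulVec, inputKet_eq, star_tensorKet_dotProduct] at this
  simpa only [star_inputFactor_dotProduct_self, Finset.prod_const_one] using this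

/-- The trace is a product of one-qubit expectations. For `y ≠ x` the factor at the site of `y`
vanishes: `X` and `Y` have mean zero in `|0⟩`, and each has mean zero in the `+1` eigenvector of the
other. For `y = x` every factor is `1`. -/
theorem trace_majorana_mul_inputState (y x : MajIdx d) :
    Matrix.trace (majorana y * inputState x) = if y = x then 1 else 0 := by
  have h := inv_sqrt_two_mul_self
  have h' := Complex.I_mul_I
  rw [trace_mul_inputState, inputKet_eq, majorana_eq, tensorOp_mulVec, star_tensorKet_dotProduct]
  split_ifs with hxy
  · subst hxy
    refine Finset.prod_eq_one fun j _ => ?_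
    unfold inputFactor majoranaFactor
    rcases lt_trichotomy j y.1 with hj | hj | hj
    · simp [hj, hj.ne, ketZero, pauliZ, dotProduct, Matrix.mulVec]
    · subst hj
      by_cases hy : y.2 = 0
      · simp [hy, ketPlusX, pauliX, dotProduct, Matrix.mulVec]
        linear_combination 2 * h
      · simp [hy, ketPlusY, pauliY, dotProduct, Matrix.mulVec]
        linear_combination (-2 * Complex.I * Complex.I) * h - h'
    · simp [hj.not_gt, hj.ne', ketZero, dotProduct, Matrix.mulVec]
  · refine Finset.prod_eq_zero (Finset.mem_univ y.1) ?_
    unfold inputFactor majoranaFactor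
    by_cases hj : y.1 = x.1
    · obtain ⟨p, a⟩ := x
      obtain ⟨q, b⟩ := y
      obtain rfl : q = p := hj
      fin_cases a <;> fin_cases b <;>
        simp [ketPlusX, ketPlusY, pauliX, pauliY, dotProduct, Matrix.mulVec] at hxy ⊢
      all_goals ring
    · by_cases hy : y.2 = 0 <;>
        simp [hj, hy, ketZero, pauliX, pauliY, dotProduct, Matrix.mulVec]


/-! ### Conjugation by Gaussian unitaries -/


section Conjugation

open scoped Matrix.Norms.Operator

/-- The real-linear map `B ↦ m(B v)`. -/
noncomputable def majoranaMulVec (v : MajIdx d → ℝ) : MajMat d →ₗ[ℝ] QOp d where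
  toFun B := majoranaVec (B *ᵥ v)
  map_add' B C := by rw [Matrix.add_mulVec, majoranaVec_add]
  map_smul' c B := by rw [Matrix.smul_mulVec, majoranaVec_smul]; rfl

/-- The curve `e^{-tX} m(e^{tA} v) e^{tX}` is constant: by `majoranaQuad_commutator` the change of
the vector cancels the commutator with `X`. Compare `t = 0` and `t = 1`. -/
theorem exp_majoranaQuad_mul_majoranaVec {A : MajMat d} (hA : Aᵀ = -A) (v : MajIdx d → ℝ) :
    NormedSpace.exp ((1 / 4 : ℂ) • majoranaQuad A) * majoranaVec v
      = majoranaVec (NormedSpace.exp A *ᵥ v) * NormedSpace.exp ((1 / 4 : ℂ) • majoranaQuad A) := by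
  set X : QOp d := (1 / 4 : ℂ) • majoranaQuad A with hX
  let f : ℝ → QOp d := fun t =>
    NormedSpace.exp (t • (-X)) * majoranaVec (NormedSpace.exp (t • A) *ᵥ v) * NormedSpace.exp (t • X)
  have hf : ∀ t, HasDerivAt f 0 t := by
    intro t
    have h1 := hasDerivAt_exp_smul_const (𝕂 := ℝ) (-X) t
    have h2 := hasDerivAt_exp_smul_const' (𝕂 := ℝ) X t
    have h3 := hasDerivAt_exp_smul_const' (𝕂 := ℝ) A t
    have h4 : HasDerivAt (fun t : ℝ => majoranaVec (NormedSpace.exp (t • A) *ᵥ v))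
        (majoranaVec ((A * NormedSpace.exp (t • A)) *ᵥ v)) t :=
      (majoranaMulVec v).toContinuousLinearMap.hasFDerivAt.comp_hasDerivAt t h3
    refine ((h1.fun_mul h4).fun_mul h2).congr_deriv ?_
    rw [← Matrix.mulVec_mulVec, ← majoranaQuad_commutator hA, ← hX]
    noncomm_ring
  have hconst : f 1 = f 0 :=
    is_const_of_deriv_eq_zero (fun t => (hf t).differentiableAt) (fun t => (hf t).deriv) 1 0
  have hinv : NormedSpace.exp X * NormedSpace.exp (-X) = 1 := by
    rw [← Matrix.exp_add_of_commute _ _ (Commute.refl X).neg_right, add_neg_cancel,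
      NormedSpace.exp_zero]
  simp only [f, one_smul, zero_smul, NormedSpace.exp_zero, one_mul, mul_one,
    Matrix.one_mulVec] at hconst
  rw [← hconst, ← mul_assoc, ← mul_assoc, hinv, one_mul]

end Conjugation

theorem majoranaQuad_mem_skewAdjoint {A : MajMat d} (hA : Aᵀ = -A) :
    (1 / 4 : ℂ) • majoranaQuad A ∈ skewAdjoint (QOp d) := by
  rw [skewAdjoint.mem_iff, Matrix.star_eq_conjTranspose, Matrix.conjTranspose_smul,
    majoranaQuad_conjTranspose, hA, majoranaQuad_neg, smul_neg]
  simp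

/-! ### Unitarity and operator norm estimates -/

section Norm

open scoped Matrix.Norms.L2Operator

theorem exp_majoranaQuad_mem_unitary {A : MajMat d} (hA : Aᵀ = -A) :
    NormedSpace.exp ((1 / 4 : ℂ) • majoranaQuad A) ∈ unitary (QOp d) :=
  let _ : NormedAlgebra ℚ (QOp d) := NormedAlgebra.restrictScalars ℚ ℂ _
  NormedSpace.exp_mem_unitary_of_mem_skewAdjoint (majoranaQuad_mem_skewAdjoint hA)

theorem norm_majoranaVec (v : MajIdx d → ℝ) : ‖majoranaVec v‖ = √(∑ i, v i ^ 2) := by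
  have h : ‖majoranaVec v‖ * ‖majoranaVec v‖ = ∑ i, v i ^ 2 := by
    rw [← CStarRing.norm_star_mul_self, Matrix.star_eq_conjTranspose, majoranaVec_conjTranspose,
      majoranaVec_sq, norm_smul, CStarRing.norm_one, mul_one, Complex.norm_real,
      Real.norm_of_nonneg (Finset.sum_nonneg fun i _ => sq_nonneg _)]
  rw [← h, Real.sqrt_mul_self (norm_nonneg _)]

theorem norm_majorana (i : MajIdx d) : ‖(majorana i : QOp d)‖ = 1 := by
  rw [← majoranaVec_single, norm_majoranaVec]
  simp [Pi.single_apply]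

/-- The squared Frobenius norm of a real matrix. -/
def frobSq (M : MajMat d) : ℝ := ∑ i, ∑ j, M i j ^ 2

theorem frobSq_nonneg (M : MajMat d) : 0 ≤ frobSq M :=
  Finset.sum_nonneg fun _ _ => Finset.sum_nonneg fun _ _ => sq_nonneg _

/-- Grouped by rows, the operator is a sum of `2d` products `m_i m(A_i)` whose norms are at most the
Euclidean norms of the rows; Cauchy–Schwarz over the rows costs the factor `√(2d)`. -/
theorem norm_majoranaQuad_le (A : MajMat d) :
    ‖majoranaQuad A‖ ≤ √(2 * d) * √(frobSq A) := by
  have hcard : (Fintype.card (MajIdx d) : ℝ) = 2 * d := by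
    simp [mul_comm]
  calc ‖majoranaQuad A‖ ≤ ∑ i, ‖majorana i * majoranaVec (A i)‖ := by
        rw [majoranaQuad_eq]; exact norm_sum_le _ _
    _ ≤ ∑ i, 1 * √(∑ j, A i j ^ 2) := by
        refine Finset.sum_le_sum fun i _ => (norm_mul_le _ _).trans ?_
        rw [norm_majorana, one_mul, one_mul, norm_majoranaVec]
    _ ≤ √(∑ _i : MajIdx d, (1 : ℝ) ^ 2) * √(∑ i, √(∑ j, A i j ^ 2) ^ 2) :=
        Real.sum_mul_le_sqrt_mul_sqrt _ _ _
    _ = √(2 * d) * √(frobSq A) := by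
        rw [frobSq, ← hcard]
        simp only [one_pow, Finset.sum_const, Finset.card_univ, nsmul_eq_mul, mul_one]
        congr 2
        exact Finset.sum_congr rfl fun i _ =>
          Real.sq_sqrt (Finset.sum_nonneg fun j _ => sq_nonneg _)

/-- Along `t ↦ exp(tX)` the speed is `‖exp(tX) X‖ = ‖X‖`, because `exp(tX)` is unitary. -/
theorem norm_exp_sub_one_le {n : Type*} [Fintype n] [DecidableEq n] {X : Matrix n n ℂ}
    (hX : X ∈ skewAdjoint (Matrix n n ℂ)) : ‖NormedSpace.exp X - 1‖ ≤ ‖X‖ := by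
  let _ : NormedAlgebra ℚ (Matrix n n ℂ) := NormedAlgebra.restrictScalars ℚ ℂ _
  have hsk : ∀ t : ℝ, t • X ∈ skewAdjoint (Matrix n n ℂ) := fun t =>
    skewAdjoint.smul_mem t hX
  have hd : ∀ t : ℝ, HasDerivAt (fun t : ℝ => NormedSpace.exp (t • X))
      (NormedSpace.exp (t • X) * X) t := fun t => by
    simpa using hasDerivAt_exp_smul_const (𝕂 := ℝ) X t
  have hb : ∀ t ∈ Set.Ico (0 : ℝ) 1, ‖NormedSpace.exp (t • X) * X‖ ≤ ‖X‖ := fun t _ => by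
    rw [CStarRing.norm_mem_unitary_mul _
      (NormedSpace.exp_mem_unitary_of_mem_skewAdjoint (hsk t))]
  have := norm_image_sub_le_of_norm_deriv_le_segment' (fun t _ => (hd t).hasDerivWithinAt) hb 1
    (Set.right_mem_Icc.2 zero_le_one)
  simpa using this

end Norm

/-! ### Operators that commute with all Majorana operators -/

theorem tensorOp_diagonal (v : Fin d → Fin 2 → ℂ) :
    tensorOp (fun j => Matrix.diagonal (v j)) = Matrix.diagonal (tensorKet v) := by
  ext s t
  simp only [tensorOp, tensorKet, Matrix.of_apply, Matrix.diagonal_apply]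
  split_ifs with h
  · simp [h]
  · obtain ⟨j, hj⟩ := Function.ne_iff.1 h
    exact Finset.prod_eq_zero (Finset.mem_univ j) (by simp [hj])

/-- The `Z` strings cancel and `X Y = i Z` remains at site `p`. Afterwards only `c ≠ 0` matters. -/
theorem majorana_mul_majorana_eq_diagonal (p : Fin d) :
    ∃ c : ℂ, c ≠ 0 ∧ majorana (p, 0) * majorana (p, 1) =
      Matrix.diagonal fun s : Qubits d => if s p = 0 then c else -c := by
  refine ⟨Complex.I, Complex.I_ne_zero, ?_⟩
  have h : ∀ j, majoranaFactor (p, 0) j * majoranaFactor (p, 1) j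
      = Matrix.diagonal (if j = p then ![Complex.I, -Complex.I] else ![1, 1]) := by
    intro j
    unfold majoranaFactor
    rcases lt_trichotomy j p with hj | hj | hj
    · ext a b; fin_cases a <;> fin_cases b <;> simp [hj, hj.ne, pauliZ, Matrix.mul_apply]
    · subst hj
      ext a b; fin_cases a <;> fin_cases b <;> simp [pauliX, pauliY, Matrix.mul_apply]
    · ext a b; fin_cases a <;> fin_cases b <;> simp [hj.not_gt, hj.ne']
  simp only [majorana_eq, tensorOp_mul, h]
  rw [tensorOp_diagonal]
  congr 1
  ext s
  rw [tensorKet, Finset.prod_eq_single p]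
  · rcases Fin.exists_fin_two.1 ⟨s p, rfl⟩ with hs | hs <;> simp [hs]
  · intro j _ hj
    rw [if_neg hj]
    rcases Fin.exists_fin_two.1 ⟨s j, rfl⟩ with hs | hs <;> simp [hs]
  · simp

theorem majorana_apply_update (p : Fin d) (s : Qubits d) (b : Fin 2) (hb : s p ≠ b) :
    majorana (p, 0) s (Function.update s p b) ≠ 0 := by
  rw [majorana_eq, tensorOp, Matrix.of_apply, Finset.prod_ne_zero_iff]
  intro j _
  unfold majoranaFactor
  rcases lt_trichotomy j p with hj | hj | hj
  · simp only [hj, if_true, Function.update_of_ne hj.ne]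
    rcases Fin.exists_fin_two.1 ⟨s j, rfl⟩ with hs | hs <;> simp [hs, pauliZ]
  · subst hj
    revert hb
    rcases Fin.exists_fin_two.1 ⟨s j, rfl⟩ with hs | hs <;> fin_cases b <;> simp [hs, pauliX]
  · rw [Function.update_of_ne hj.ne', if_neg hj.not_gt, if_neg hj.ne', Matrix.one_apply_eq]
    exact one_ne_zero

/-- Any bit string is reached from any other by changing one bit at a time. -/
theorem eq_of_update_eq {α : Type*} {f : Qubits d → α}
    (hf : ∀ s p b, f (Function.update s p b) = f s) (s t : Qubits d) : f s = f t := by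
  suffices h : ∀ u : Finset (Fin d), f (u.piecewise s t) = f t by
    simpa using h Finset.univ
  intro u
  induction u using Finset.induction_on with
  | empty => simp
  | insert p u _ ih => rw [Finset.piecewise_insert, hf, ih]

/-- The commutant of the Majorana operators consists of the scalars. -/
theorem exists_eq_smul_one_of_commute {T : QOp d}
    (hT : ∀ y, T * majorana y = majorana y * T) : ∃ c : ℂ, T = c • 1 := by
  -- `T` commutes with `Z_p` up to a scalar, and `Z_p` has opposite eigenvalues on `s` and `t` where
  -- their bits differ.
  have hoff : ∀ s t, s ≠ t → T s t = 0 := by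
    intro s t hst
    obtain ⟨p, hp⟩ := Function.ne_iff.1 hst
    obtain ⟨c, hc, hZ⟩ := majorana_mul_majorana_eq_diagonal p
    have hcomm : T * (majorana (p, 0) * majorana (p, 1))
        = (majorana (p, 0) * majorana (p, 1)) * T := by
      rw [← mul_assoc, hT, mul_assoc, hT, mul_assoc]
    rw [hZ] at hcomm
    have h := congr_fun (congr_fun hcomm s) t
    rw [Matrix.mul_diagonal, Matrix.diagonal_mul] at h
    by_cases hs : s p = 0
    · have ht : ¬ t p = 0 := fun ht => hp (hs.trans ht.symm)
      rw [if_pos hs, if_neg ht] at h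
      have h2 : (2 * c) * T s t = 0 := by linear_combination -h
      exact (mul_eq_zero.1 h2).resolve_left (by simp [hc])
    · have ht : t p = 0 := by
        revert hp hs
        generalize s p = a; generalize t p = b
        revert a b; decide
      rw [if_neg hs, if_pos ht] at h
      have h2 : (2 * c) * T s t = 0 := by linear_combination h
      exact (mul_eq_zero.1 h2).resolve_left (by simp [hc])
  have hdiag : T = Matrix.diagonal fun s => T s s := by
    ext s t
    rw [Matrix.diagonal_apply]
    split_ifs with h
    · rw [h]
    · exact hoff s t h
  -- `majorana (p, 0)` flips bit `p` with a nonzero amplitude, so commuting with it equates the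
  -- diagonal entries before and after the flip.
  have hupd : ∀ (s : Qubits d) p b,
      T (Function.update s p b) (Function.update s p b) = T s s := by
    intro s p b
    by_cases hb : s p = b
    · subst hb; rw [Function.update_eq_self]
    · have h := congr_fun (congr_fun (hT (p, 0)) s) (Function.update s p b)
      rw [hdiag, Matrix.mul_diagonal, Matrix.diagonal_mul, mul_comm] at h
      exact (mul_left_cancel₀ (majorana_apply_update p s b hb) h).symm
  refine ⟨T 0 0, ?_⟩
  conv_lhs => rw [hdiag]
  rw [← Algebra.algebraMap_eq_smul_one, Matrix.algebraMap_eq_diagonal]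
  congr 1
  ext s
  exact eq_of_update_eq (f := fun s => T s s) hupd s 0


/-! ### Trace norm and diamond norm -/

section DiamondNorm

open scoped Matrix.Norms.L2Operator Kronecker

variable {n : Type*} [Fintype n] [DecidableEq n]

theorem norm_apply_le_l2_opNorm (A : Matrix n n ℂ) (i j : n) : ‖A i j‖ ≤ ‖A‖ := by
  have h := A.l2_opNorm_mulVec (EuclideanSpace.single j (1 : ℂ))
  rw [PiLp.norm_single, norm_one, mul_one] at h
  refine le_trans ?_ h
  have h2 := PiLp.norm_apply_le
    (WithLp.toLp 2 (A *ᵥ (EuclideanSpace.single j (1 : ℂ)).ofLp)) i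
  simpa [Matrix.mulVec_single] using h2

/-- A partial singular value decomposition: the columns of `X U` are orthogonal and their lengths
are the singular values of `X`. -/
theorem conjTranspose_mul_self_eigenvectors (X : Matrix n n ℂ) :
    ∃ U ∈ Matrix.unitaryGroup n ℂ, (X * U)ᴴ * (X * U) =
      Matrix.diagonal fun i =>
        (((Matrix.isHermitian_conjTranspose_mul_self X).eigenvalues i : ℝ) : ℂ) := by
  set h := Matrix.isHermitian_conjTranspose_mul_self X
  refine ⟨h.eigenvectorUnitary, h.eigenvectorUnitary.2, ?_⟩
  have := h.conjStarAlgAut_star_eigenvectorUnitary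
  rw [Unitary.conjStarAlgAut_apply] at this
  rw [Matrix.conjTranspose_mul, Matrix.mul_assoc, ← Matrix.mul_assoc Xᴴ, ← Matrix.mul_assoc]
  simpa [Matrix.star_eq_conjTranspose, Function.comp_def] using this

/-- Hölder duality. In the basis of right singular vectors, the trace pairs rows of length at most
`‖C‖` with columns whose lengths are the singular values. -/
theorem norm_trace_mul_le (C X : Matrix n n ℂ) :
    ‖Matrix.trace (C * X)‖ ≤ ‖C‖ * traceNorm X := by
  obtain ⟨U, hU, hY⟩ := conjTranspose_mul_self_eigenvectors X
  set lam := (Matrix.isHermitian_conjTranspose_mul_self X).eigenvalues with hlam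
  set Y := X * U with hYdef
  set G := Uᴴ * C with hG
  have hUU : U * Uᴴ = 1 := (Matrix.mem_unitaryGroup_iff).1 hU
  have htr : Matrix.trace (C * X) = ∑ i, ∑ k, G i k * Y k i := by
    have : Matrix.trace (C * X) = Matrix.trace (G * Y) := by
      rw [Matrix.trace_mul_comm G, hG, hYdef, Matrix.mul_assoc, ← Matrix.mul_assoc U, hUU,
        Matrix.one_mul, Matrix.trace_mul_comm]
    rw [this]; rfl
  have hGn : ‖G‖ ≤ ‖C‖ := by
    rw [hG, ← Matrix.star_eq_conjTranspose, CStarRing.norm_mem_unitary_mul _ (Unitary.star_mem hU)]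
  have hrow : ∀ i, ∑ k, ‖G i k‖ ^ 2 ≤ ‖C‖ ^ 2 := by
    intro i
    have h1 := norm_apply_le_l2_opNorm (G * Gᴴ) i i
    have h2 : (G * Gᴴ) i i = ((∑ k, ‖G i k‖ ^ 2 : ℝ) : ℂ) := by
      simp [Matrix.mul_apply, Complex.mul_conj, Complex.normSq_eq_norm_sq]
    rw [h2, Complex.norm_real, Real.norm_of_nonneg (by positivity),
      ← Matrix.star_eq_conjTranspose, CStarRing.norm_self_mul_star] at h1
    nlinarith [norm_nonneg G, norm_nonneg C]
  have hcol : ∀ i, ∑ k, ‖Y k i‖ ^ 2 = lam i := by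
    intro i
    have h1 := congr_fun (congr_fun hY i) i
    have h2 : (Yᴴ * Y) i i = ((∑ k, ‖Y k i‖ ^ 2 : ℝ) : ℂ) := by
      simp [Matrix.mul_apply, mul_comm, Complex.mul_conj, Complex.normSq_eq_norm_sq]
    rw [h2, Matrix.diagonal_apply_eq] at h1
    exact_mod_cast h1
  rw [htr, traceNorm, Finset.mul_sum]
  refine (norm_sum_le _ _).trans (Finset.sum_le_sum fun i _ => ?_)
  calc ‖∑ k, G i k * Y k i‖ ≤ ∑ k, ‖G i k‖ * ‖Y k i‖ := by
        refine (norm_sum_le _ _).trans (le_of_eq ?_)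
        simp
    _ ≤ √(∑ k, ‖G i k‖ ^ 2) * √(∑ k, ‖Y k i‖ ^ 2) := Real.sum_mul_le_sqrt_mul_sqrt _ _ _
    _ ≤ ‖C‖ * √(lam i) := by
        rw [hcol]
        exact mul_le_mul_of_nonneg_right (Real.sqrt_le_iff.2 ⟨norm_nonneg _, hrow i⟩)
          (Real.sqrt_nonneg _)

theorem exists_trace_mul_eq_traceNorm (X : Matrix n n ℂ) :
    ∃ C : Matrix n n ℂ, ‖C‖ ≤ 1 ∧ Matrix.trace (C * X) = traceNorm X := by
  obtain ⟨U, hU, hY⟩ := conjTranspose_mul_self_eigenvectors X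
  set lam := (Matrix.isHermitian_conjTranspose_mul_self X).eigenvalues with hlam
  have hpos : ∀ i, 0 ≤ lam i := Matrix.eigenvalues_conjTranspose_mul_self_nonneg X
  set Y := X * U with hYdef
  -- Since `0⁻¹ = 0`, the matrix `U * diagonal g * (X U)ᴴ` is the adjoint of the partial isometry in
  -- the polar decomposition of `X`.
  let g : n → ℂ := fun i => (((√(lam i))⁻¹ : ℝ) : ℂ)
  have hg : ∀ i, star (g i) = g i := fun i => Complex.conj_ofReal _
  have hYY : ∀ A : Matrix n n ℂ, Yᴴ * (Y * A) = Matrix.diagonal (fun i => (lam i : ℂ)) * A := by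
    intro A; rw [← Matrix.mul_assoc, hY]
  refine ⟨U * Matrix.diagonal g * Yᴴ, ?_, ?_⟩
  · set C := U * Matrix.diagonal g * Yᴴ with hC
    have e : C * star C = U * Matrix.diagonal (fun i => g i * lam i * g i) * star U := by
      rw [hC, Matrix.star_eq_conjTranspose]
      simp only [Matrix.conjTranspose_mul, Matrix.conjTranspose_conjTranspose,
        Matrix.diagonal_conjTranspose, Matrix.mul_assoc]
      rw [hYY, ← Matrix.mul_assoc (Matrix.diagonal _), Matrix.diagonal_mul_diagonal,
        ← Matrix.mul_assoc (Matrix.diagonal _), Matrix.diagonal_mul_diagonal]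
      simp only [Pi.star_def, hg, Matrix.star_eq_conjTranspose, mul_assoc]
    have h1 : ‖C‖ * ‖C‖ ≤ 1 := by
      rw [← CStarRing.norm_self_mul_star, e, CStarRing.norm_mul_mem_unitary _ (Unitary.star_mem hU),
        CStarRing.norm_mem_unitary_mul _ hU, Matrix.l2_opNorm_diagonal,
        pi_norm_le_iff_of_nonneg zero_le_one]
      intro i
      simp only [g, ← Complex.ofReal_mul, Complex.norm_real]
      rcases (hpos i).eq_or_lt with h0 | h0
      · simp [← h0]
      · have hs := Real.sqrt_pos.2 h0
        have : (√(lam i))⁻¹ * lam i * (√(lam i))⁻¹ = 1 := by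
          field_simp
          rw [Real.sq_sqrt h0.le]
        rw [this, norm_one]
    nlinarith [norm_nonneg C]
  · rw [Matrix.mul_assoc, Matrix.mul_assoc, Matrix.trace_mul_comm, Matrix.mul_assoc,
      Matrix.mul_assoc, ← hYdef, hY, Matrix.diagonal_mul_diagonal, Matrix.trace_diagonal]
    change _ = ((∑ i, √(lam i) : ℝ) : ℂ)
    rw [Complex.ofReal_sum]
    refine Finset.sum_congr rfl fun i _ => ?_
    simp only [g, ← Complex.ofReal_mul]
    congr 1
    rcases (hpos i).eq_or_lt with h0 | h0
    · simp [← h0]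
    · have hs := Real.sqrt_pos.2 h0
      field_simp
      rw [Real.sq_sqrt h0.le]

theorem traceNorm_nonneg (X : Matrix n n ℂ) : 0 ≤ traceNorm X :=
  Finset.sum_nonneg fun _ _ => Real.sqrt_nonneg _

/-- By trace-norm duality it suffices to bound `Vᴴ C V - Wᴴ C W = Vᴴ C (V - W) + (V - W)ᴴ C W` for a
contraction `C`. -/
theorem traceNorm_conj_sub_conj_le {V W : Matrix n n ℂ} (hV : ‖V‖ ≤ 1) (hW : ‖W‖ ≤ 1)
    (X : Matrix n n ℂ) :
    traceNorm (V * X * Vᴴ - W * X * Wᴴ) ≤ 2 * ‖V - W‖ * traceNorm X := by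
  obtain ⟨C, hC, hCX⟩ := exists_trace_mul_eq_traceNorm (V * X * Vᴴ - W * X * Wᴴ)
  have e : Matrix.trace (C * (V * X * Vᴴ - W * X * Wᴴ))
      = Matrix.trace ((Vᴴ * C * (V - W) + (V - W)ᴴ * C * W) * X) := by
    have e1 : ∀ A : Matrix n n ℂ,
        Matrix.trace (C * (A * X * Aᴴ)) = Matrix.trace (Aᴴ * C * A * X) := by
      intro A
      rw [← Matrix.mul_assoc, Matrix.trace_mul_comm]
      simp only [Matrix.mul_assoc]
    have e2 : Vᴴ * C * (V - W) + (V - W)ᴴ * C * W = Vᴴ * C * V - Wᴴ * C * W := by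
      rw [Matrix.conjTranspose_sub]
      noncomm_ring
    rw [e2, Matrix.mul_sub, Matrix.trace_sub, e1, e1, Matrix.sub_mul, Matrix.trace_sub]
  have hn : ‖Vᴴ * C * (V - W) + (V - W)ᴴ * C * W‖ ≤ 2 * ‖V - W‖ := by
    have hst : ∀ A : Matrix n n ℂ, ‖Aᴴ‖ = ‖A‖ := fun A => by
      rw [← Matrix.star_eq_conjTranspose, norm_star]
    have h1 : ‖Vᴴ * C * (V - W)‖ ≤ 1 * 1 * ‖V - W‖ := by
      refine (norm_mul_le _ _).trans (mul_le_mul_of_nonneg_right ?_ (norm_nonneg _))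
      refine (norm_mul_le _ _).trans (mul_le_mul ?_ hC (norm_nonneg _) zero_le_one)
      rwa [hst]
    have h2 : ‖(V - W)ᴴ * C * W‖ ≤ ‖V - W‖ * 1 * 1 := by
      refine (norm_mul_le _ _).trans (mul_le_mul ?_ hW (norm_nonneg _) (by positivity))
      refine (norm_mul_le _ _).trans (mul_le_mul ?_ hC (norm_nonneg _) (norm_nonneg _))
      rw [hst]
    refine (norm_add_le _ _).trans ?_
    linarith
  have h : ((traceNorm (V * X * Vᴴ - W * X * Wᴴ) : ℝ) : ℂ)
      = Matrix.trace ((Vᴴ * C * (V - W) + (V - W)ᴴ * C * W) * X) := by rw [← hCX, e]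
  have h' := norm_trace_mul_le (Vᴴ * C * (V - W) + (V - W)ᴴ * C * W) X
  rw [← h, Complex.norm_real, Real.norm_of_nonneg (traceNorm_nonneg _)] at h'
  exact h'.trans (mul_le_mul_of_nonneg_right hn (traceNorm_nonneg _))

theorem traceNorm_conj_sub_conj_le_two {V W : Matrix n n ℂ} (hV : ‖V‖ ≤ 1) (hW : ‖W‖ ≤ 1)
    (X : Matrix n n ℂ) :
    traceNorm (V * X * Vᴴ - W * X * Wᴴ) ≤ 2 * traceNorm X := by
  obtain ⟨C, hC, hCX⟩ := exists_trace_mul_eq_traceNorm (V * X * Vᴴ - W * X * Wᴴ)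
  have e1 : ∀ A : Matrix n n ℂ, ‖A‖ ≤ 1 →
      ‖Matrix.trace (C * (A * X * Aᴴ))‖ ≤ traceNorm X := by
    intro A hA
    have : Matrix.trace (C * (A * X * Aᴴ)) = Matrix.trace (Aᴴ * C * A * X) := by
      rw [← Matrix.mul_assoc, Matrix.trace_mul_comm]
      simp only [Matrix.mul_assoc]
    rw [this]
    refine (norm_trace_mul_le _ _).trans (mul_le_of_le_one_left (traceNorm_nonneg _) ?_)
    have h1 : ‖Aᴴ * C‖ ≤ 1 := (norm_mul_le _ _).trans
      (mul_le_one₀ (by rwa [← Matrix.star_eq_conjTranspose, norm_star]) (norm_nonneg _) hC)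
    exact (norm_mul_le _ _).trans (mul_le_one₀ h1 (norm_nonneg _) hA)
  have h' : ‖((traceNorm (V * X * Vᴴ - W * X * Wᴴ) : ℝ) : ℂ)‖ ≤ 2 * traceNorm X := by
    rw [← hCX, Matrix.mul_sub, Matrix.trace_sub]
    refine (norm_sub_le _ _).trans ?_
    linarith [e1 V hV, e1 W hW]
  rwa [Complex.norm_real, Real.norm_of_nonneg (traceNorm_nonneg _)] at h'

/-- The ampliation `A ↦ A ⊗ 1`. -/
noncomputable def ampliation (n k : Type*) [Fintype n] [DecidableEq n] [Fintype k]
    [DecidableEq k] : Matrix n n ℂ →⋆ₙₐ[ℂ] Matrix (n × k) (n × k) ℂ where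
  toFun A := A ⊗ₖ (1 : Matrix k k ℂ)
  map_smul' c A := Matrix.smul_kronecker c A 1
  map_zero' := Matrix.zero_kronecker _
  map_add' A B := Matrix.add_kronecker A B 1
  map_mul' A B := by rw [← Matrix.mul_kronecker_mul, Matrix.one_mul]
  map_star' A := by
    simp only [Matrix.star_eq_conjTranspose]
    rw [Matrix.conjTranspose_kronecker, Matrix.conjTranspose_one]

theorem norm_ampliation_le {k : Type*} [Fintype k] [DecidableEq k] (A : Matrix n n ℂ) :
    ‖ampliation n k A‖ ≤ ‖A‖ :=
  NonUnitalStarAlgHom.norm_apply_le (ampliation n k) A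

theorem tensorId_sub {n k : Type*} (Φ Ψ : Matrix n n ℂ →ₗ[ℂ] Matrix n n ℂ)
    (X : Matrix (n × k) (n × k) ℂ) :
    tensorId (Φ - Ψ) X = tensorId Φ X - tensorId Ψ X := rfl

theorem tensorId_unitaryChannel {k : Type*} [Fintype k] [DecidableEq k] (V : Matrix n n ℂ)
    (X : Matrix (n × k) (n × k) ℂ) :
    tensorId (unitaryChannel V) X = ampliation n k V * X * (ampliation n k V)ᴴ := by
  have e : (ampliation n k V)ᴴ = Vᴴ ⊗ₖ (1 : Matrix k k ℂ) := by
    rw [← Matrix.star_eq_conjTranspose, ← map_star]; rfl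
  have e' : ampliation n k V = V ⊗ₖ (1 : Matrix k k ℂ) := rfl
  rw [e, e']
  ext ⟨i, a⟩ ⟨j, b⟩
  simp [tensorId, unitaryChannel, Matrix.mul_apply, Fintype.sum_prod_type, Matrix.one_apply,
    Finset.sum_mul]

theorem diamondNorm_sub_le_of_forall {V W : Matrix n n ℂ} {c : ℝ}
    (hc : 0 ≤ c) (h : ∀ (k : ℕ) (X : Matrix (n × Fin k) (n × Fin k) ℂ),
      traceNorm (ampliation n (Fin k) V * X * (ampliation n (Fin k) V)ᴴ
        - ampliation n (Fin k) W * X * (ampliation n (Fin k) W)ᴴ) ≤ c * traceNorm X) :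
    diamondNorm (unitaryChannel V - unitaryChannel W) ≤ ENNReal.ofReal c := by
  refine iSup_le fun k => iSup_le fun X => iSup_le fun hX => ENNReal.ofReal_le_ofReal ?_
  rw [tensorId_sub, tensorId_unitaryChannel, tensorId_unitaryChannel]
  exact (h k X).trans (mul_le_of_le_one_right hc hX)

theorem diamondNorm_unitaryChannel_sub_le {V W : Matrix n n ℂ} (hV : ‖V‖ ≤ 1) (hW : ‖W‖ ≤ 1) :
    diamondNorm (unitaryChannel V - unitaryChannel W) ≤ ENNReal.ofReal (2 * ‖V - W‖) := by
  refine diamondNorm_sub_le_of_forall (by positivity) fun k X => ?_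
  refine (traceNorm_conj_sub_conj_le ((norm_ampliation_le V).trans hV)
    ((norm_ampliation_le W).trans hW) X).trans ?_
  rw [← map_sub]
  gcongr
  · exact traceNorm_nonneg X
  · exact norm_ampliation_le _

theorem diamondNorm_unitaryChannel_sub_le_two {V W : Matrix n n ℂ} (hV : ‖V‖ ≤ 1)
    (hW : ‖W‖ ≤ 1) :
    diamondNorm (unitaryChannel V - unitaryChannel W) ≤ ENNReal.ofReal 2 :=
  diamondNorm_sub_le_of_forall zero_le_two fun _ X =>
    traceNorm_conj_sub_conj_le_two ((norm_ampliation_le V).trans hV)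
      ((norm_ampliation_le W).trans hW) X

end DiamondNorm


/-! ### Antisymmetric logarithms of special orthogonal matrices -/

section Logarithm

variable {n : Type*} [Fintype n] [DecidableEq n]

theorem exp_mem_orthogonalGroup {K : Matrix n n ℝ} (hK : Kᵀ = -K) :
    NormedSpace.exp K ∈ Matrix.orthogonalGroup n ℝ := by
  rw [Matrix.mem_orthogonalGroup_iff, ← Matrix.exp_transpose, hK,
    ← Matrix.exp_add_of_commute _ _ (Commute.refl K).neg_right, add_neg_cancel,
    NormedSpace.exp_zero]

/-- Orthogonality leaves `±1`, and `exp K` is the square of `exp(K/2)`. -/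
theorem det_exp_of_transpose_eq_neg {K : Matrix n n ℝ} (hK : Kᵀ = -K) :
    (NormedSpace.exp K).det = 1 := by
  have h1 : (NormedSpace.exp K).det * (NormedSpace.exp K).det = 1 := by
    have := (Matrix.mem_orthogonalGroup_iff n ℝ).1 (exp_mem_orthogonalGroup hK)
    simpa using congr_arg Matrix.det this
  have h2 : NormedSpace.exp K
      = NormedSpace.exp ((1 / 2 : ℝ) • K) * NormedSpace.exp ((1 / 2 : ℝ) • K) := by
    rw [← Matrix.exp_add_of_commute _ _ (Commute.refl _), ← add_smul]
    norm_num
  have h3 : 0 ≤ (NormedSpace.exp K).det := by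
    rw [h2, Matrix.det_mul]
    exact mul_self_nonneg _
  nlinarith

theorem hasSum_sinc (x : ℝ) :
    HasSum (fun k : ℕ => (-1) ^ k * x ^ (2 * k) / ((2 * k + 1).factorial : ℝ)) (Real.sinc x) := by
  rcases eq_or_ne x 0 with rfl | hx
  · have : Real.sinc 0 = (-1) ^ 0 * (0 : ℝ) ^ (2 * 0) / ((2 * 0 + 1).factorial : ℝ) := by simp
    rw [this]
    refine hasSum_single 0 fun k hk => ?_
    simp [hk]
  · rw [Real.sinc_of_ne_zero hx]
    refine ((Real.hasSum_sin x).div_const x).congr_fun ?_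
    intro k
    rw [pow_succ]
    field_simp

/-- Euler's formula: even powers of `K` are diagonal and sum to `cos`, odd ones carry an extra `K`.
Using `sinc` avoids dividing by zero angles. -/
theorem exp_eq_of_mul_self_eq {K : Matrix n n ℝ} {θ : n → ℝ}
    (hK : K * K = -Matrix.diagonal fun i => θ i ^ 2) :
    NormedSpace.exp K = (Matrix.diagonal fun i => Real.cos (θ i))
      + (Matrix.diagonal fun i => Real.sinc (θ i)) * K := by
  have hs : HasSum (fun k : ℕ => ((k.factorial : ℝ)⁻¹) • K ^ k) (NormedSpace.exp K) := by
    open scoped Matrix.Norms.Operator in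
    exact NormedSpace.exp_series_hasSum_exp' (𝕂 := ℝ) K
  have heven : ∀ k, K ^ (2 * k) = Matrix.diagonal fun i => (-1) ^ k * θ i ^ (2 * k) := by
    intro k
    rw [pow_mul, pow_two, hK, Matrix.diagonal_neg, Matrix.diagonal_pow]
    congr 1
    ext i
    simp only [Pi.pow_apply, neg_pow (θ i ^ 2), pow_mul]
  have h1 : HasSum (fun k : ℕ => ((2 * k).factorial⁻¹ : ℝ) • K ^ (2 * k))
      (Matrix.diagonal fun i => Real.cos (θ i)) := by
    have : ∀ k : ℕ, ((2 * k).factorial⁻¹ : ℝ) • K ^ (2 * k)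
        = Matrix.diagonal fun i => (-1) ^ k * θ i ^ (2 * k) / ((2 * k).factorial : ℝ) := by
      intro k
      rw [heven, ← Matrix.diagonal_smul]
      congr 1
      ext i
      simp only [Pi.smul_apply, smul_eq_mul]
      ring
    simp only [this]
    exact (Pi.hasSum.2 fun i => Real.hasSum_cos (θ i)).matrix_diagonal
  have h2 : HasSum (fun k : ℕ => ((2 * k + 1).factorial⁻¹ : ℝ) • K ^ (2 * k + 1))
      ((Matrix.diagonal fun i => Real.sinc (θ i)) * K) := by
    have : ∀ k : ℕ, ((2 * k + 1).factorial⁻¹ : ℝ) • K ^ (2 * k + 1)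
        = (Matrix.diagonal fun i => (-1) ^ k * θ i ^ (2 * k) / ((2 * k + 1).factorial : ℝ)) * K := by
      intro k
      rw [pow_succ, heven, ← smul_mul_assoc, ← Matrix.diagonal_smul]
      congr 2
      ext i
      simp only [Pi.smul_apply, smul_eq_mul]
      ring
    simp only [this]
    exact (Pi.hasSum.2 fun i => hasSum_sinc (θ i)).matrix_diagonal.mul_right K
  exact hs.unique (HasSum.even_add_odd (f := fun k : ℕ => ((k.factorial : ℝ)⁻¹) • K ^ k) h1 h2)

/-- A complex structure on the coordinate subspace of an even number of coordinates. -/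
theorem exists_complexStructure (p : n → Prop) [DecidablePred p]
    (hp : Even (Fintype.card {i // p i})) :
    ∃ J : Matrix n n ℝ, Jᵀ = -J ∧
      J * J = -Matrix.diagonal (fun i => if p i then 1 else 0) ∧
      (Matrix.diagonal fun i => if p i then 1 else 0) * J = J ∧
      J * (Matrix.diagonal fun i => if p i then 1 else 0) = J := by
  obtain ⟨m, hm⟩ := hp
  have hcard : Fintype.card {i // p i} = Fintype.card (Fin m × Fin 2) := by
    rw [hm, Fintype.card_prod, Fintype.card_fin, Fintype.card_fin, mul_two]
  let e := Fintype.equivOfCardEq hcard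
  -- `E` includes the selected coordinates, grouped in pairs; `J = E B Eᵀ` is a quarter turn in each
  -- pair.
  let E : Matrix n (Fin m × Fin 2) ℝ := Matrix.of fun i x => if i = (e.symm x : n) then 1 else 0
  let j : Matrix (Fin 2) (Fin 2) ℝ := !![0, -1; 1, 0]
  let B : Matrix (Fin m × Fin 2) (Fin m × Fin 2) ℝ :=
    Matrix.kroneckerMap (· * ·) (1 : Matrix (Fin m) (Fin m) ℝ) j
  have hj : j * j = -1 := by
    ext a b; fin_cases a <;> fin_cases b <;> simp [j, Matrix.mul_apply]
  have hjt : jᵀ = -j := by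
    ext a b; fin_cases a <;> fin_cases b <;> simp [j]
  have hB : B * B = -1 := by
    have : B * B = Matrix.kroneckerMap (· * ·) (1 * 1 : Matrix (Fin m) (Fin m) ℝ) (j * j) :=
      (Matrix.mul_kronecker_mul _ _ _ _).symm
    rw [this, hj, one_mul]
    ext ⟨a, b⟩ ⟨a', b'⟩
    by_cases h : a = a' <;> simp [Matrix.one_apply, h]
  have hBt : Bᵀ = -B := by
    ext ⟨a, b⟩ ⟨a', b'⟩
    have := congr_fun (congr_fun hjt b) b'
    simp only [Matrix.transpose_apply, Matrix.neg_apply] at this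
    by_cases h : a = a'
    · simp [B, h, this]
    · simp [B, h, Ne.symm h]
  have hEE : Eᵀ * E = 1 := by
    ext x y
    simp [E, Matrix.mul_apply, Matrix.one_apply, Subtype.val_inj, eq_comm]
  have hEE' : E * Eᵀ = Matrix.diagonal fun i => if p i then 1 else 0 := by
    ext i k
    simp only [E, Matrix.mul_apply, Matrix.transpose_apply, Matrix.of_apply,
      Matrix.diagonal_apply]
    by_cases hi : p i
    · rw [Finset.sum_eq_single (e ⟨i, hi⟩)]
      · simp [hi, eq_comm]
      · intro x _ hx
        rw [if_neg, zero_mul]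
        rintro rfl
        simp at hx
      · simp
    · have : ∀ x, i ≠ (e.symm x : n) := fun x h => hi (h ▸ (e.symm x).2)
      simp [this, hi]
  refine ⟨E * B * Eᵀ, ?_, ?_, ?_, ?_⟩
  · rw [Matrix.transpose_mul, Matrix.transpose_mul, Matrix.transpose_transpose, hBt,
      Matrix.neg_mul, Matrix.mul_neg, Matrix.mul_assoc]
  · rw [← hEE']
    calc E * B * Eᵀ * (E * B * Eᵀ) = E * B * (Eᵀ * E) * B * Eᵀ := by
          simp only [Matrix.mul_assoc]
      _ = E * (B * B) * Eᵀ := by rw [hEE, Matrix.mul_one, Matrix.mul_assoc E]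
      _ = _ := by rw [hB]; simp
  · rw [← hEE', Matrix.mul_assoc E Eᵀ, ← Matrix.mul_assoc Eᵀ, ← Matrix.mul_assoc Eᵀ, hEE,
      Matrix.one_mul, Matrix.mul_assoc]
  · rw [← hEE', Matrix.mul_assoc, ← Matrix.mul_assoc Eᵀ, hEE, Matrix.one_mul]

theorem mul_sinc_self (x : ℝ) : x * Real.sinc x = Real.sin x := by
  rcases eq_or_ne x 0 with rfl | hx
  · simp
  · rw [Real.sinc_of_ne_zero hx, mul_div_cancel₀ _ hx]

/-- With `D = cos θ`, Euler's formula suggests `K = N / sinc θ`. This fails only at `D = -1`, where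
`θ = π` and `sinc θ = 0`; there `π J` serves, with `J` a complex structure on that eigenspace, which
exists because the determinant makes its dimension even. -/
theorem exists_log_of_diagonal_add {D : n → ℝ} {N : Matrix n n ℝ} (hN : Nᵀ = -N)
    (hNN : N * N = Matrix.diagonal fun i => D i ^ 2 - 1)
    (hc : Matrix.diagonal D * N = N * Matrix.diagonal D)
    (hdet : (Matrix.diagonal D + N).det = 1) :
    ∃ K : Matrix n n ℝ, Kᵀ = -K ∧ NormedSpace.exp K = Matrix.diagonal D + N ∧
      K * K = -Matrix.diagonal fun i => Real.arccos (D i) ^ 2 := by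
  classical
  have hN' : ∀ i j, N j i = -N i j := fun i j => congr_fun (congr_fun hN i) j
  have hrow : ∀ i, ∑ j, N i j ^ 2 = 1 - D i ^ 2 := by
    intro i
    have h := congr_fun (congr_fun hNN i) i
    rw [Matrix.mul_apply, Matrix.diagonal_apply_eq] at h
    have e : ∑ j, N i j * N j i = -∑ j, N i j ^ 2 := by
      rw [← Finset.sum_neg_distrib]
      exact Finset.sum_congr rfl fun j _ => by rw [hN' i j]; ring
    linarith
  have hD : ∀ i, -1 ≤ D i ∧ D i ≤ 1 := by
    intro i
    have h : 0 ≤ 1 - D i ^ 2 := hrow i ▸ Finset.sum_nonneg fun j _ => sq_nonneg _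
    exact abs_le.1 (abs_le_one_iff_mul_self_le_one.2 (by nlinarith))
  have hcos : ∀ i, Real.cos (Real.arccos (D i)) = D i := fun i =>
    Real.cos_arccos (hD i).1 (hD i).2
  have hzero : ∀ i, D i = -1 → ∀ j, N i j = 0 := by
    intro i hi j
    have h := hrow i
    rw [hi] at h
    norm_num at h
    have := (Finset.sum_eq_zero_iff_of_nonneg (fun j _ => sq_nonneg (N i j))).1 h j
      (Finset.mem_univ j)
    exact pow_eq_zero_iff two_ne_zero |>.1 this
  have heq : ∀ i j, N i j ≠ 0 → D i = D j := by
    intro i j hij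
    have h := congr_fun (congr_fun hc i) j
    rw [Matrix.diagonal_mul, Matrix.mul_diagonal, mul_comm] at h
    exact mul_left_cancel₀ hij h
  set θ : n → ℝ := fun i => Real.arccos (D i) with hθ
  have hsinc : ∀ i, D i ≠ -1 → Real.sinc (θ i) ≠ 0 := by
    intro i hi h0
    have h := mul_sinc_self (θ i)
    rw [h0, mul_zero] at h
    rcases eq_or_ne (θ i) 0 with h1 | h1
    · rw [h1, Real.sinc_zero] at h0
      exact one_ne_zero h0
    · have hlt : θ i < Real.pi := by
        refine lt_of_le_of_ne (Real.arccos_le_pi _) fun h2 => hi ?_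
        rw [← hcos i, show Real.arccos (D i) = Real.pi from h2, Real.cos_pi]
      have := Real.sin_pos_of_pos_of_lt_pi
        (lt_of_le_of_ne (Real.arccos_nonneg (D i)) (Ne.symm h1)) hlt
      exact this.ne h
  have hsin : ∀ i, (θ i * Real.sinc (θ i)) ^ 2 = 1 - D i ^ 2 := by
    intro i
    rw [mul_sinc_self, Real.sin_sq, hcos]
  let g : n → ℝ := fun i => if D i = -1 then 0 else (Real.sinc (θ i))⁻¹
  let θ₀ : n → ℝ := fun i => if D i = -1 then 0 else θ i
  have hgN : N * Matrix.diagonal g = Matrix.diagonal g * N := by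
    ext i j
    rw [Matrix.diagonal_mul, Matrix.mul_diagonal, mul_comm]
    by_cases h : N i j = 0
    · simp [h]
    · simp only [g, hθ, heq i j h]
  obtain ⟨K₀, hK₀⟩ : ∃ K₀, K₀ = Matrix.diagonal g * N := ⟨_, rfl⟩
  have hK₀t : K₀ᵀ = -K₀ := by
    rw [hK₀, Matrix.transpose_mul, hN, Matrix.diagonal_transpose, Matrix.neg_mul, hgN]
  have hK₀sq : K₀ * K₀ = -Matrix.diagonal fun i => θ₀ i ^ 2 := by
    have : K₀ * K₀ = Matrix.diagonal g * Matrix.diagonal g * (N * N) := by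
      rw [hK₀, Matrix.mul_assoc, ← Matrix.mul_assoc N, hgN]
      simp only [Matrix.mul_assoc]
    rw [this, hNN, Matrix.diagonal_mul_diagonal, Matrix.diagonal_mul_diagonal,
      Matrix.diagonal_neg]
    congr 1
    ext i
    by_cases h : D i = -1
    · simp [g, θ₀, h]
    · have h1 := hsin i
      have h2 := hsinc i h
      simp only [g, θ₀, if_neg h]
      field_simp
      linarith
  -- `K₀` vanishes on the eigenvalue `-1`, where its exponential is the identity, so a sign matrix
  -- is needed to recover the rotation.
  have hexp₀ : (Matrix.diagonal fun i => if D i = -1 then (-1 : ℝ) else 1) * NormedSpace.exp K₀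
      = Matrix.diagonal D + N := by
    rw [exp_eq_of_mul_self_eq hK₀sq, hK₀]
    ext i j
    rw [Matrix.diagonal_mul, Matrix.add_apply, Matrix.add_apply, Matrix.diagonal_mul,
      Matrix.diagonal_mul]
    by_cases h : D i = -1
    · by_cases hij : i = j
      · subst hij; simp [θ₀, h, hzero i h]
      · simp [θ₀, h, hzero i h, hij]
    · have h2 : Real.sinc (Real.arccos (D i)) ≠ 0 := hsinc i h
      by_cases hij : i = j
      · subst hij; simp [θ₀, g, h, h2, hθ, hcos]
      · simp [θ₀, g, h, h2, hij, hθ]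
  -- In `hexp₀` the determinant of the sign matrix must be `1`.
  have heven : Even (Fintype.card {i // D i = -1}) := by
    have h := congr_arg Matrix.det hexp₀
    rw [Matrix.det_mul, det_exp_of_transpose_eq_neg hK₀t, mul_one, hdet, Matrix.det_diagonal,
      Finset.prod_ite, Finset.prod_const, Finset.prod_const_one, mul_one,
      ← Fintype.card_subtype] at h
    by_contra hodd
    rw [Nat.not_even_iff_odd] at hodd
    rw [hodd.neg_one_pow] at h
    norm_num at h
  obtain ⟨J, hJt, hJJ, hPJ, hJP⟩ := exists_complexStructure (fun i => D i = -1) heven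
  set Pr : Matrix n n ℝ := Matrix.diagonal fun i => if D i = -1 then 1 else 0 with hPr
  have hPK : Pr * K₀ = 0 := by
    rw [hK₀, ← Matrix.mul_assoc, hPr, Matrix.diagonal_mul_diagonal]
    ext i j
    rw [Matrix.diagonal_mul]
    by_cases h : D i = -1 <;> simp [g, h]
  have hKP : K₀ * Pr = 0 := by
    have h := congr_arg Matrix.transpose hPK
    rw [Matrix.transpose_mul, hK₀t, hPr, Matrix.diagonal_transpose, Matrix.transpose_zero,
      Matrix.neg_mul, neg_eq_zero] at h
    exact h
  have hsq : (K₀ + Real.pi • J) * (K₀ + Real.pi • J) = -Matrix.diagonal fun i => θ i ^ 2 := by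
    have h1 : K₀ * J = 0 := by rw [← hPJ, ← Matrix.mul_assoc, hKP, Matrix.zero_mul]
    have h2 : J * K₀ = 0 := by rw [← hJP, Matrix.mul_assoc, hPK, Matrix.mul_zero]
    rw [Matrix.add_mul, Matrix.mul_add, Matrix.mul_add, Matrix.smul_mul, Matrix.mul_smul,
      Matrix.smul_mul, Matrix.mul_smul, h1, h2, hJJ, hK₀sq, hPr]
    ext i j
    by_cases hij : i = j
    · subst hij
      by_cases h : D i = -1
      · simp [θ₀, h, hθ]; ring
      · simp [θ₀, h]
    · simp [hij]
  refine ⟨K₀ + Real.pi • J, ?_, ?_, hsq⟩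
  · rw [Matrix.transpose_add, Matrix.transpose_smul, hK₀t, hJt, smul_neg, neg_add]
  · rw [exp_eq_of_mul_self_eq hsq, Matrix.mul_add, Matrix.mul_smul, ← hPJ, ← Matrix.mul_assoc,
      hPr, Matrix.diagonal_mul_diagonal, hK₀, ← Matrix.mul_assoc, Matrix.diagonal_mul_diagonal]
    ext i j
    simp only [Matrix.add_apply, Matrix.smul_apply, Matrix.diagonal_mul]
    by_cases h : D i = -1
    · have hs : Real.sinc Real.pi = 0 := by
        rw [Real.sinc_of_ne_zero Real.pi_ne_zero, Real.sin_pi, zero_div]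
      by_cases hij : i = j
      · subst hij; simp [h, hs, hθ, hzero i h]
      · simp [h, hs, hθ, hzero i h, hij]
    · have h2 : Real.sinc (Real.arccos (D i)) ≠ 0 := hsinc i h
      by_cases hij : i = j
      · subst hij; simp [g, h, h2, hθ, hcos]
      · simp [g, h, h2, hij, hθ]

/-- Arc against chord: `2(1 - cos θ) = (2 sin(θ/2))²`, and Jordan's inequality gives `sin(θ/2) ≥
θ/π`. -/
theorem arccos_sq_le {c : ℝ} (h₁ : -1 ≤ c) (h₂ : c ≤ 1) :
    Real.arccos c ^ 2 ≤ Real.pi ^ 2 / 4 * (2 * (1 - c)) := by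
  have h0 := Real.arccos_nonneg c
  have hpi := Real.arccos_le_pi c
  have h := Real.mul_le_sin (x := Real.arccos c / 2) (by linarith) (by linarith)
  have hc : c = 1 - 2 * Real.sin (Real.arccos c / 2) ^ 2 := by
    have h3 := Real.cos_sq (Real.arccos c / 2)
    have h4 := Real.sin_sq_add_cos_sq (Real.arccos c / 2)
    rw [mul_div_cancel₀ _ (two_ne_zero' ℝ), Real.cos_arccos h₁ h₂] at h3
    linarith
  have hp := Real.pi_pos
  have h5 : Real.arccos c ≤ Real.pi * Real.sin (Real.arccos c / 2) := by
    have h6 : 2 / Real.pi * (Real.arccos c / 2) = Real.arccos c / Real.pi := by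
      field_simp
    rw [h6, div_le_iff₀ hp] at h
    linarith
  have h7 : Real.arccos c ^ 2 ≤ (Real.pi * Real.sin (Real.arccos c / 2)) ^ 2 :=
    pow_le_pow_left₀ h0 h5 2
  have h8 : Real.pi ^ 2 / 4 * (2 * (1 - c))
      = (Real.pi * Real.sin (Real.arccos c / 2)) ^ 2 := by
    conv_lhs => rw [hc]
    ring
  rw [h8]
  exact h7

/-- Every special orthogonal matrix has an antisymmetric logarithm whose Frobenius norm is at
most `π / 2` times its distance from the identity. -/
theorem exists_log_of_mem_orthogonalGroup {W : Matrix n n ℝ}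
    (hW : W ∈ Matrix.orthogonalGroup n ℝ) (hdet : W.det = 1) :
    ∃ K : Matrix n n ℝ, Kᵀ = -K ∧ NormedSpace.exp K = W ∧
      Matrix.trace (Kᵀ * K) ≤ Real.pi ^ 2 / 4 * Matrix.trace ((W - 1)ᵀ * (W - 1)) := by
  have hWW : W * Wᵀ = 1 := (Matrix.mem_orthogonalGroup_iff n ℝ).1 hW
  have hWW' : Wᵀ * W = 1 := (Matrix.mem_orthogonalGroup_iff' n ℝ).1 hW
  -- Diagonalizing the symmetric part of `W` brings it to the form `diagonal D + N`; the two parts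
  -- commute because `W` is normal.
  set S : Matrix n n ℝ := (1 / 2 : ℝ) • (W + Wᵀ) with hS
  have hSh : S.IsHermitian := by
    rw [Matrix.IsHermitian, Matrix.conjTranspose_eq_transpose_of_trivial, hS,
      Matrix.transpose_smul, Matrix.transpose_add, Matrix.transpose_transpose, add_comm]
  set D := hSh.eigenvalues with hDdef
  set U : Matrix n n ℝ := hSh.eigenvectorUnitary.val with hU
  have hUU : U * Uᵀ = 1 :=
    (Matrix.mem_orthogonalGroup_iff n ℝ).1 hSh.eigenvectorUnitary.2
  have hUU' : Uᵀ * U = 1 :=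
    (Matrix.mem_orthogonalGroup_iff' n ℝ).1 hSh.eigenvectorUnitary.2
  have hdiag : Uᵀ * S * U = Matrix.diagonal D := by
    have := hSh.conjStarAlgAut_star_eigenvectorUnitary
    rw [Unitary.conjStarAlgAut_apply] at this
    simpa [Matrix.star_eq_conjTranspose, Function.comp_def] using this
  have hcancel : ∀ A B : Matrix n n ℝ, Uᵀ * A * U * (Uᵀ * B * U) = Uᵀ * (A * B) * U := by
    intro A B
    calc Uᵀ * A * U * (Uᵀ * B * U) = Uᵀ * A * (U * Uᵀ) * B * U := by
          simp only [Matrix.mul_assoc]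
      _ = _ := by rw [hUU, Matrix.mul_one]; simp only [Matrix.mul_assoc]
  set N : Matrix n n ℝ := Uᵀ * ((1 / 2 : ℝ) • (W - Wᵀ)) * U with hNdef
  have hDN : Matrix.diagonal D + N = Uᵀ * W * U := by
    rw [← hdiag, hNdef, ← Matrix.add_mul, ← Matrix.mul_add, hS]
    congr 2
    module
  have hDN' : Matrix.diagonal D - N = Uᵀ * Wᵀ * U := by
    rw [← hdiag, hNdef, ← Matrix.sub_mul, ← Matrix.mul_sub, hS]
    congr 2
    module
  have h1 : (Matrix.diagonal D + N) * (Matrix.diagonal D - N) = 1 := by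
    rw [hDN, hDN', hcancel, hWW, Matrix.mul_one, hUU']
  have h2 : (Matrix.diagonal D - N) * (Matrix.diagonal D + N) = 1 := by
    rw [hDN, hDN', hcancel, hWW', Matrix.mul_one, hUU']
  have hc : Matrix.diagonal D * N = N * Matrix.diagonal D := by
    have h3 : (2 : ℝ) • (Matrix.diagonal D * N) = (2 : ℝ) • (N * Matrix.diagonal D) := by
      have h4 := h2.trans h1.symm
      rw [Matrix.sub_mul, Matrix.add_mul, Matrix.mul_add, Matrix.mul_add, Matrix.mul_sub,
        Matrix.mul_sub] at h4
      rw [two_smul, two_smul]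
      rw [← sub_eq_zero] at h4 ⊢
      rw [← h4]
      abel
    exact smul_right_injective _ two_ne_zero h3
  have hNN : N * N = Matrix.diagonal fun i => D i ^ 2 - 1 := by
    have h3 : N * N = Matrix.diagonal D * Matrix.diagonal D - 1 := by
      rw [Matrix.add_mul, Matrix.mul_sub, Matrix.mul_sub, hc] at h1
      rw [← h1]
      abel
    rw [h3, Matrix.diagonal_mul_diagonal, ← Matrix.diagonal_one, Matrix.diagonal_sub]
    congr 1
    ext i
    ring
  have hNt : Nᵀ = -N := by
    rw [hNdef, Matrix.transpose_mul, Matrix.transpose_mul, Matrix.transpose_transpose,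
      Matrix.transpose_smul, Matrix.transpose_sub, Matrix.transpose_transpose,
      ← neg_sub W, smul_neg, Matrix.neg_mul, Matrix.mul_neg, Matrix.mul_assoc]
  have hd : (Matrix.diagonal D + N).det = 1 := by
    rw [hDN, Matrix.det_mul, Matrix.det_mul, hdet, mul_one, ← Matrix.det_mul, hUU',
      Matrix.det_one]
  obtain ⟨K, hKt, hKe, hKK⟩ := exists_log_of_diagonal_add hNt hNN hc hd
  have hUinv : U⁻¹ = Uᵀ := Matrix.inv_eq_right_inv hUU
  refine ⟨U * K * Uᵀ, ?_, ?_, ?_⟩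
  · rw [Matrix.transpose_mul, Matrix.transpose_mul, Matrix.transpose_transpose, hKt,
      Matrix.neg_mul, Matrix.mul_neg, Matrix.mul_assoc]
  · rw [← hUinv, Matrix.exp_conj _ _ (IsUnit.of_mul_eq_one _ hUU), hKe, hDN, hUinv]
    calc U * (Uᵀ * W * U) * Uᵀ = (U * Uᵀ) * W * (U * Uᵀ) := by simp only [Matrix.mul_assoc]
      _ = W := by rw [hUU, Matrix.one_mul, Matrix.mul_one]
  · have hDb : ∀ i, -1 ≤ D i ∧ D i ≤ 1 := by
      intro i
      have h3 := congr_fun (congr_fun hNN i) i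
      rw [Matrix.mul_apply, Matrix.diagonal_apply_eq] at h3
      have e : ∑ j, N i j * N j i = -∑ j, N i j ^ 2 := by
        rw [← Finset.sum_neg_distrib]
        refine Finset.sum_congr rfl fun j _ => ?_
        have : N j i = -N i j := congr_fun (congr_fun hNt i) j
        rw [this]; ring
      have h4 : 0 ≤ ∑ j, N i j ^ 2 := Finset.sum_nonneg fun j _ => sq_nonneg _
      exact abs_le.1 (abs_le_one_iff_mul_self_le_one.2 (by nlinarith))
    have hl : Matrix.trace ((U * K * Uᵀ)ᵀ * (U * K * Uᵀ)) = ∑ i, Real.arccos (D i) ^ 2 := by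
      have e : (U * K * Uᵀ)ᵀ * (U * K * Uᵀ) = U * (-(K * K)) * Uᵀ := by
        rw [Matrix.transpose_mul, Matrix.transpose_mul, Matrix.transpose_transpose, hKt]
        calc U * (-K * Uᵀ) * (U * K * Uᵀ) = U * (-K) * (Uᵀ * U) * K * Uᵀ := by
              simp only [Matrix.mul_assoc]
          _ = _ := by rw [hUU', Matrix.mul_one]; simp only [Matrix.mul_assoc, Matrix.neg_mul]
      rw [e, Matrix.trace_mul_comm, ← Matrix.mul_assoc, hUU', Matrix.one_mul, hKK, neg_neg,
        Matrix.trace_diagonal]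
    have hr : Matrix.trace ((W - 1)ᵀ * (W - 1)) = ∑ i, 2 * (1 - D i) := by
      have e : (W - 1)ᵀ * (W - 1) = (2 : ℝ) • (1 - S) := by
        rw [Matrix.transpose_sub, Matrix.transpose_one, Matrix.sub_mul, Matrix.mul_sub, hWW',
          Matrix.mul_one, Matrix.one_mul, hS]
        module
      have e2 : Matrix.trace S = ∑ i, D i := by
        rw [hSh.trace_eq_sum_eigenvalues]; rfl
      rw [e, Matrix.trace_smul, Matrix.trace_sub, Matrix.trace_one, e2, ← Finset.mul_sum,
        Finset.sum_sub_distrib]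
      simp
    rw [hl, hr, Finset.mul_sum]
    exact Finset.sum_le_sum fun i _ => arccos_sq_le (hDb i).1 (hDb i).2

end Logarithm



/-! ### Polar factors -/

theorem frobSq_eq_trace (M : MajMat d) : frobSq M = Matrix.trace (Mᵀ * M) := by
  simp only [frobSq, Matrix.trace, Matrix.diag, Matrix.mul_apply, Matrix.transpose_apply, pow_two]
  exact Finset.sum_comm

theorem frobSq_add_le (M N : MajMat d) : frobSq (M + N) ≤ 2 * frobSq M + 2 * frobSq N := by
  simp only [frobSq, Finset.mul_sum, ← Finset.sum_add_distrib]
  refine Finset.sum_le_sum fun i _ => Finset.sum_le_sum fun j _ => ?_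
  rw [Matrix.add_apply]
  nlinarith [sq_nonneg (M i j - N i j)]

theorem frobSq_sub_comm (M N : MajMat d) : frobSq (M - N) = frobSq (N - M) := by
  simp only [frobSq, Matrix.sub_apply]
  exact Finset.sum_congr rfl fun i _ => Finset.sum_congr rfl fun j _ => by ring

theorem frobSq_orthogonal_mul {O : MajMat d} (hO : O ∈ Matrix.orthogonalGroup (MajIdx d) ℝ)
    (M : MajMat d) : frobSq (O * M) = frobSq M := by
  have h : Oᵀ * O = 1 := (Matrix.mem_orthogonalGroup_iff' _ ℝ).1 hO
  rw [frobSq_eq_trace, frobSq_eq_trace, Matrix.transpose_mul, Matrix.mul_assoc,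
    ← Matrix.mul_assoc Oᵀ, h, Matrix.one_mul]

theorem frobSq_sub_orthogonal {O : MajMat d} (hO : O ∈ Matrix.orthogonalGroup (MajIdx d) ℝ)
    (M : MajMat d) :
    frobSq (M - O) = frobSq M + Matrix.trace (1 : MajMat d) - 2 * Matrix.trace (Oᵀ * M) := by
  have h : Oᵀ * O = 1 := (Matrix.mem_orthogonalGroup_iff' _ ℝ).1 hO
  have h2 : Matrix.trace (Mᵀ * O) = Matrix.trace (Oᵀ * M) := by
    rw [← Matrix.trace_transpose, Matrix.transpose_mul, Matrix.transpose_transpose]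
  rw [frobSq_eq_trace, frobSq_eq_trace, Matrix.transpose_sub, Matrix.sub_mul, Matrix.mul_sub,
    Matrix.mul_sub, h, Matrix.trace_sub, Matrix.trace_sub, Matrix.trace_sub, h2]
  ring

/-- The trace of the positive semidefinite `(1 - R) P (1 - R)ᵀ` is `2 tr P - 2 tr(R P)`. -/
theorem trace_orthogonal_mul_le {R P : MajMat d}
    (hR : R ∈ Matrix.orthogonalGroup (MajIdx d) ℝ) (hP : P.PosSemidef) :
    Matrix.trace (R * P) ≤ Matrix.trace P := by
  have hRR : Rᵀ * R = 1 := (Matrix.mem_orthogonalGroup_iff' _ ℝ).1 hR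
  have h := (hP.mul_mul_conjTranspose_same (1 - R)).trace_nonneg
  have hPt : Pᵀ = P := by
    have := hP.isHermitian
    rwa [Matrix.IsHermitian, Matrix.conjTranspose_eq_transpose_of_trivial] at this
  have h2 : Matrix.trace (P * Rᵀ) = Matrix.trace (R * P) := by
    rw [← Matrix.trace_transpose, Matrix.transpose_mul, Matrix.transpose_transpose, hPt]
  have h3 : Matrix.trace (R * P * Rᵀ) = Matrix.trace P := by
    rw [Matrix.trace_mul_comm, ← Matrix.mul_assoc, hRR, Matrix.one_mul]
  rw [Matrix.conjTranspose_eq_transpose_of_trivial, Matrix.transpose_sub, Matrix.transpose_one,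
    Matrix.sub_mul, Matrix.one_mul, Matrix.mul_sub, Matrix.mul_one, Matrix.sub_mul,
    Matrix.trace_sub, Matrix.trace_sub, Matrix.trace_sub, h2, h3] at h
  linarith

/-- A polar factor of `M` is a nearest orthogonal matrix. -/
theorem IsPolarFactor.frobSq_sub_le {M Q O : MajMat d} (hQ : IsPolarFactor M Q)
    (hO : O ∈ Matrix.orthogonalGroup (MajIdx d) ℝ) : frobSq (M - Q) ≤ frobSq (M - O) := by
  obtain ⟨hQo, P, hP, rfl⟩ := hQ
  rw [frobSq_sub_orthogonal hO, frobSq_sub_orthogonal hQo]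
  have hQQ : Qᵀ * Q = 1 := (Matrix.mem_orthogonalGroup_iff' _ ℝ).1 hQo
  have hR : Oᵀ * Q ∈ Matrix.orthogonalGroup (MajIdx d) ℝ :=
    mul_mem (Unitary.star_mem hO) hQo
  have h := trace_orthogonal_mul_le hR hP
  rw [← Matrix.mul_assoc Qᵀ, hQQ, Matrix.one_mul, ← Matrix.mul_assoc]
  linarith

theorem IsPolarFactor.frobSq_sub_orthogonal_le {M Q O : MajMat d} (hQ : IsPolarFactor M Q)
    (hO : O ∈ Matrix.orthogonalGroup (MajIdx d) ℝ) : frobSq (O - Q) ≤ 4 * frobSq (M - O) := by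
  have h := frobSq_add_le (O - M) (M - Q)
  rw [sub_add_sub_cancel, frobSq_sub_comm O M] at h
  linarith [hQ.frobSq_sub_le hO]

/-! ### Polar factors near the special orthogonal group -/

theorem mulVec_sq_le (E : MajMat d) (v : MajIdx d → ℝ) :
    ∑ i, (E *ᵥ v) i ^ 2 ≤ frobSq E * ∑ j, v j ^ 2 := by
  rw [frobSq, Finset.sum_mul]
  exact Finset.sum_le_sum fun i _ => Finset.sum_mul_sq_le_sq_mul_sq _ _ _

theorem mulVec_sq_of_orthogonal {O : MajMat d} (hO : O ∈ Matrix.orthogonalGroup (MajIdx d) ℝ)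
    (v : MajIdx d → ℝ) : ∑ i, (O *ᵥ v) i ^ 2 = ∑ j, v j ^ 2 := by
  have h : Oᵀ * O = 1 := (Matrix.mem_orthogonalGroup_iff' _ ℝ).1 hO
  have e : ∀ w : MajIdx d → ℝ, ∑ i, w i ^ 2 = w ⬝ᵥ w := fun w => by
    simp [dotProduct, pow_two]
  rw [e, e, Matrix.dotProduct_mulVec, ← Matrix.mulVec_transpose, Matrix.mulVec_mulVec, h,
    Matrix.one_mulVec]

/-- The determinant cannot vanish on the segment from `O` to `M`: if `(O + tE)v = 0` with `E = M -
O`, then `|v| = |Ov| = t|Ev|`, which is less than `|v|` for `v ≠ 0`. -/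
theorem det_pos_of_frobSq_sub_lt_one {M O : MajMat d} (hO : O ∈ SO d)
    (h : frobSq (M - O) < 1) : 0 < M.det := by
  let f : ℝ → ℝ := fun t => (O + t • (M - O)).det
  have hf : Continuous f := by
    refine Continuous.matrix_det ?_
    fun_prop
  have hne : ∀ t ∈ Set.Icc (0 : ℝ) 1, f t ≠ 0 := by
    intro t ht h0
    obtain ⟨v, hv, hv0⟩ := Matrix.exists_mulVec_eq_zero_iff.2 h0
    have e1 : O *ᵥ v = -(t • ((M - O) *ᵥ v)) := by
      rw [Matrix.add_mulVec, Matrix.smul_mulVec] at hv0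
      exact eq_neg_of_add_eq_zero_left hv0
    have e2 : ∑ j, v j ^ 2 = t ^ 2 * ∑ i, ((M - O) *ᵥ v) i ^ 2 := by
      rw [← mulVec_sq_of_orthogonal hO.1 v, e1, Finset.mul_sum]
      refine Finset.sum_congr rfl fun i _ => ?_
      simp only [Pi.neg_apply, Pi.smul_apply, smul_eq_mul]
      ring
    have hpos : 0 < ∑ j, v j ^ 2 := by
      obtain ⟨j, hj⟩ := Function.ne_iff.1 hv
      refine Finset.sum_pos' (fun i _ => sq_nonneg _) ⟨j, Finset.mem_univ j, ?_⟩
      have hj' : v j ≠ 0 := hj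
      positivity
    have e3 := mulVec_sq_le (M - O) v
    have ht2 : t ^ 2 ≤ 1 := pow_le_one₀ ht.1 ht.2
    have e4 : 0 ≤ ∑ i, ((M - O) *ᵥ v) i ^ 2 := Finset.sum_nonneg fun _ _ => sq_nonneg _
    nlinarith
  have hf0 : f 0 = 1 := by simp [f, hO.2]
  have hf1 : f 1 = M.det := by simp [f]
  by_contra hneg
  rw [not_lt, ← hf1] at hneg
  obtain ⟨t, ht, ht0⟩ := intermediate_value_Icc' zero_le_one hf.continuousOn
    (show (0 : ℝ) ∈ Set.Icc (f 1) (f 0) from ⟨hneg, hf0 ▸ zero_le_one⟩)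
  exact hne t ht ht0

open scoped MatrixOrder Matrix.Norms.L2Operator in
/-- A matrix with positive determinant has exactly one polar factor, which has determinant `1`. -/
theorem exists_unique_isPolarFactor {M : MajMat d} (hM : 0 < M.det) :
    ∃ Q ∈ SO d, ∀ Q' : MajMat d, IsPolarFactor M Q' ↔ Q' = Q := by
  have hA : (Mᵀ * M).PosSemidef := by
    have := Matrix.posSemidef_conjTranspose_mul_self M
    rwa [Matrix.conjTranspose_eq_transpose_of_trivial] at this
  set P := CFC.sqrt (Mᵀ * M) with hPdef
  have hP : P.PosSemidef := Matrix.nonneg_iff_posSemidef.1 (CFC.sqrt_nonneg (Mᵀ * M))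
  have hPP : P * P = Mᵀ * M := CFC.sqrt_mul_sqrt_self _ hA.nonneg
  have hPt : Pᵀ = P := by
    have := hP.isHermitian
    rwa [Matrix.IsHermitian, Matrix.conjTranspose_eq_transpose_of_trivial] at this
  have hdet : P.det * P.det = M.det * M.det := by
    rw [← Matrix.det_mul, hPP, Matrix.det_mul, Matrix.det_transpose]
  have hPd : 0 < P.det := lt_of_le_of_ne hP.det_nonneg fun h0 => by
    rw [← h0] at hdet
    nlinarith
  have hPu : IsUnit P.det := hPd.ne'.isUnit
  have hPi : P * P⁻¹ = 1 := Matrix.mul_nonsing_inv _ hPu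
  have hPi' : P⁻¹ * P = 1 := Matrix.nonsing_inv_mul _ hPu
  have hMQ : M = M * P⁻¹ * P := by rw [Matrix.mul_assoc, hPi', Matrix.mul_one]
  have hQ : M * P⁻¹ ∈ Matrix.orthogonalGroup (MajIdx d) ℝ := by
    rw [Matrix.mem_orthogonalGroup_iff']
    change (M * P⁻¹)ᵀ * (M * P⁻¹) = 1
    rw [Matrix.transpose_mul, Matrix.transpose_nonsing_inv, hPt, Matrix.mul_assoc,
      ← Matrix.mul_assoc Mᵀ, ← hPP, Matrix.mul_assoc, hPi, Matrix.mul_one, hPi']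
  have hQd : (M * P⁻¹).det = 1 := by
    have h1 : (M * P⁻¹).det * P.det = M.det := by rw [← Matrix.det_mul, ← hMQ]
    have h2 : P.det = M.det := by nlinarith
    rw [h2] at h1
    exact mul_right_cancel₀ hM.ne' (h1.trans (one_mul _).symm)
  refine ⟨M * P⁻¹, ⟨hQ, hQd⟩, fun Q' => ⟨?_, ?_⟩⟩
  · rintro ⟨hQ', P', hP', hM'⟩
    have hP't : P'ᵀ = P' := by
      have := hP'.isHermitian
      rwa [Matrix.IsHermitian, Matrix.conjTranspose_eq_transpose_of_trivial] at this
    have hQQ : Q'ᵀ * Q' = 1 := (Matrix.mem_orthogonalGroup_iff' _ ℝ).1 hQ'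
    have h1 : P' * P' = Mᵀ * M := by
      rw [hM', Matrix.transpose_mul, hP't, Matrix.mul_assoc, ← Matrix.mul_assoc Q'ᵀ, hQQ,
        Matrix.one_mul]
    -- Any positive factor is the unique positive square root of `Mᵀ M`; since it is invertible, it
    -- determines the orthogonal factor.
    have h2 : P = P' := CFC.sqrt_unique h1 hP'.nonneg
    conv_rhs => rw [hM', ← h2, Matrix.mul_assoc, hPi, Matrix.mul_one]
  · rintro rfl
    exact ⟨hQ, P, hP, hMQ⟩

theorem polarSO_eq {M Q : MajMat d} (hQ : Q ∈ SO d)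
    (h : ∀ Q' : MajMat d, IsPolarFactor M Q' ↔ Q' = Q) : polarSO M = Q := by
  have hex : ∃ Q : MajMat d, Q ∈ SO d ∧ IsPolarFactor M Q := ⟨Q, hQ, (h Q).2 rfl⟩
  rw [polarSO, dif_pos hex]
  exact (h _).1 hex.choose_spec.2

/-! ### The channel of the estimate -/

theorem soLog_transpose (O : MajMat d) : (soLog O)ᵀ = -soLog O := by
  rw [soLog]
  split_ifs with h
  · exact h.choose_spec.1
  · simp

theorem exp_soLog {O : MajMat d} (hO : O ∈ SO d) : NormedSpace.exp (soLog O) = O := by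
  have h : ∃ A : MajMat d, Aᵀ = -A ∧ NormedSpace.exp A = O := by
    obtain ⟨K, hK, hK', -⟩ := exists_log_of_mem_orthogonalGroup hO.1 hO.2
    exact ⟨K, hK, hK'⟩
  rw [soLog, dif_pos h]
  exact h.choose_spec.2

theorem exp_mem_SO {B : MajMat d} (hB : Bᵀ = -B) : NormedSpace.exp B ∈ SO d :=
  ⟨exp_mem_orthogonalGroup hB, det_exp_of_transpose_eq_neg hB⟩

/-- The two factors `i` multiply to `-1`, hence the sign change `B = -A`. -/
theorem IsActiveFLO.exists_eq_exp {V : QOp d} (hV : IsActiveFLO V) :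
    ∃ B : MajMat d, Bᵀ = -B ∧ V = NormedSpace.exp ((1 / 4 : ℂ) • majoranaQuad B) := by
  obtain ⟨A, hA, rfl⟩ := hV
  refine ⟨-A, by rw [Matrix.transpose_neg, hA], ?_⟩
  rw [majoranaQuad_neg, smul_smul, smul_neg, ← neg_smul]
  congr 2
  linear_combination (1 / 4 : ℂ) * Complex.I_mul_I

theorem unitaryChannel_smul {n : Type*} [Fintype n] {c : ℂ} (hc : c * star c = 1)
    (V : Matrix n n ℂ) : unitaryChannel (c • V) = unitaryChannel V := by
  ext1 ρ
  simp only [unitaryChannel, LinearMap.coe_mk, AddHom.coe_mk, Matrix.conjTranspose_smul,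
    Matrix.smul_mul, Matrix.mul_smul, smul_smul]
  rw [mul_comm, hc, one_smul]

/-- Unitaries that act alike on the Majorana operators define the same channel. -/
theorem unitaryChannel_eq_of_mul_majoranaVec {V W : QOp d} (hV : V ∈ unitary (QOp d))
    (hW : W ∈ unitary (QOp d)) (O : MajMat d)
    (hVO : ∀ v, V * majoranaVec v = majoranaVec (O *ᵥ v) * V)
    (hWO : ∀ v, W * majoranaVec v = majoranaVec (O *ᵥ v) * W) :
    unitaryChannel V = unitaryChannel W := by
  have hWW : star W * W = 1 := Unitary.star_mul_self_of_mem hW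
  have hWW' : W * star W = 1 := Unitary.mul_star_self_of_mem hW
  -- `W† V` lies in the commutant of the Majorana operators, so it is a scalar, and unitarity makes
  -- the scalar a phase.
  have hcomm : ∀ y, star W * V * majorana y = majorana y * (star W * V) := by
    intro y
    rw [← majoranaVec_single y]
    set v : MajIdx d → ℝ := Pi.single y 1
    have h1 : star W * majoranaVec (O *ᵥ v) = majoranaVec v * star W := by
      calc star W * majoranaVec (O *ᵥ v)
          = star W * (majoranaVec (O *ᵥ v) * W) * star W := by
            rw [mul_assoc (star W), mul_assoc _ W, hWW', mul_one]
        _ = majoranaVec v * star W := by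
            rw [← hWO, ← mul_assoc, hWW, one_mul]
    rw [mul_assoc, hVO, ← mul_assoc, h1, mul_assoc]
  obtain ⟨c, hc⟩ := exists_eq_smul_one_of_commute hcomm
  have hVW : V = c • W := by
    calc V = W * (star W * V) := by rw [← mul_assoc, hWW', one_mul]
      _ = c • W := by rw [hc, mul_smul_comm, mul_one]
  have hcc : c * star c = 1 := by
    have hT : star W * V ∈ unitary (QOp d) := mul_mem (Unitary.star_mem hW) hV
    have h1 := Unitary.mul_star_self_of_mem hT
    rw [hc, star_smul, star_one, smul_mul_smul_comm, one_mul] at h1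
    have h2 := congr_fun (congr_fun h1 0) 0
    simpa using h2
  rw [hVW, unitaryChannel_smul hcc]

section

open scoped Matrix.Norms.L2Operator

theorem norm_le_one_of_mem_unitary {V : QOp d} (hV : V ∈ unitary (QOp d)) : ‖V‖ ≤ 1 :=
  (CStarRing.norm_of_mem_unitary hV).le

theorem piAct_mem_unitary (O : MajMat d) : piAct O ∈ unitary (QOp d) :=
  exp_majoranaQuad_mem_unitary (soLog_transpose O)

/-- `V` is replaced by `piAct Q * U`, where `U` implements `Qᵀ O`. This fixes the phase and reduces
the distance to `‖U - 1‖`, controlled by a short logarithm of `Qᵀ O`. -/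
theorem diamondNorm_sub_piAct_le {B Q : MajMat d} (hB : Bᵀ = -B) (hQ : Q ∈ SO d) :
    diamondNorm (unitaryChannel (NormedSpace.exp ((1 / 4 : ℂ) • majoranaQuad B))
        - unitaryChannel (piAct Q))
      ≤ ENNReal.ofReal (√(2 * d) * (Real.pi / 4 * √(frobSq (NormedSpace.exp B - Q)))) := by
  set O := NormedSpace.exp B with hOdef
  have hO : O ∈ SO d := exp_mem_SO hB
  set V := NormedSpace.exp ((1 / 4 : ℂ) • majoranaQuad B)
  have hVu : V ∈ unitary (QOp d) := exp_majoranaQuad_mem_unitary hB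
  have hpu := piAct_mem_unitary Q
  have hQQ : Q * Qᵀ = 1 := (Matrix.mem_orthogonalGroup_iff _ ℝ).1 hQ.1
  have hQQ' : Qᵀ * Q = 1 := (Matrix.mem_orthogonalGroup_iff' _ ℝ).1 hQ.1
  have hQs : Qᵀ ∈ Matrix.orthogonalGroup (MajIdx d) ℝ := Unitary.star_mem hQ.1
  have hW : Qᵀ * O ∈ Matrix.orthogonalGroup (MajIdx d) ℝ := mul_mem hQs hO.1
  have hWd : (Qᵀ * O).det = 1 := by
    rw [Matrix.det_mul, Matrix.det_transpose, hQ.2, hO.2, one_mul]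
  obtain ⟨K, hK, hKe, hKn⟩ := exists_log_of_mem_orthogonalGroup hW hWd
  set U := NormedSpace.exp ((1 / 4 : ℂ) • majoranaQuad K) with hU
  have hUu : U ∈ unitary (QOp d) := exp_majoranaQuad_mem_unitary hK
  have hch : unitaryChannel V = unitaryChannel (piAct Q * U) := by
    refine unitaryChannel_eq_of_mul_majoranaVec hVu (mul_mem hpu hUu) O
      (fun v => exp_majoranaQuad_mul_majoranaVec hB v) fun v => ?_
    have h1 : U * majoranaVec v = majoranaVec ((Qᵀ * O) *ᵥ v) * U := by
      rw [← hKe]; exact exp_majoranaQuad_mul_majoranaVec hK v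
    have h2 : ∀ w, piAct Q * majoranaVec w = majoranaVec (Q *ᵥ w) * piAct Q := by
      intro w
      have := exp_majoranaQuad_mul_majoranaVec (soLog_transpose Q) w
      rwa [exp_soLog hQ] at this
    rw [mul_assoc, h1, ← mul_assoc, h2, Matrix.mulVec_mulVec, ← Matrix.mul_assoc, hQQ,
      Matrix.one_mul, mul_assoc]
  rw [hch]
  refine (diamondNorm_unitaryChannel_sub_le (norm_le_one_of_mem_unitary (mul_mem hpu hUu))
    (norm_le_one_of_mem_unitary hpu)).trans (ENNReal.ofReal_le_ofReal ?_)
  have h1 : ‖piAct Q * U - piAct Q‖ ≤ 1 / 4 * ‖majoranaQuad K‖ := by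
    have e : piAct Q * U - piAct Q = piAct Q * (U - 1) := by rw [mul_sub, mul_one]
    rw [e, CStarRing.norm_mem_unitary_mul _ hpu]
    refine (norm_exp_sub_one_le (majoranaQuad_mem_skewAdjoint hK)).trans ?_
    rw [norm_smul]
    norm_num
  have h2 : √(frobSq K) ≤ Real.pi / 2 * √(frobSq (O - Q)) := by
    have e : Qᵀ * O - 1 = Qᵀ * (O - Q) := by rw [Matrix.mul_sub, hQQ']
    rw [← frobSq_eq_trace, ← frobSq_eq_trace, e, frobSq_orthogonal_mul hQs] at hKn
    refine Real.sqrt_le_iff.2 ⟨by positivity, hKn.trans (le_of_eq ?_)⟩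
    rw [mul_pow, Real.sq_sqrt (frobSq_nonneg _)]
    ring
  have h3 := norm_majoranaQuad_le K
  have h4 : 0 ≤ √(2 * (d : ℝ)) := Real.sqrt_nonneg _
  calc 2 * ‖piAct Q * U - piAct Q‖ ≤ 1 / 2 * (√(2 * d) * √(frobSq K)) := by linarith
    _ ≤ 1 / 2 * (√(2 * d) * (Real.pi / 2 * √(frobSq (O - Q)))) := by gcongr
    _ = _ := by ring

theorem diamondNorm_sub_piAct_le_two {V : QOp d} (hV : V ∈ unitary (QOp d)) (Q : MajMat d) :
    diamondNorm (unitaryChannel V - unitaryChannel (piAct Q)) ≤ ENNReal.ofReal 2 :=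
  diamondNorm_unitaryChannel_sub_le_two (norm_le_one_of_mem_unitary hV)
    (norm_le_one_of_mem_unitary (piAct_mem_unitary Q))

end

theorem diamondNorm_sub_polarSO_le {B M : MajMat d} (hd : 0 < d) (hB : Bᵀ = -B) {ε : ℝ}
    (hε : 0 < ε) (hQ : polarSO M ∈ SO d) (hpol : IsPolarFactor M (polarSO M))
    (hM : frobSq (M - NormedSpace.exp B) ≤ ε ^ 2 / (7 * d)) :
    diamondNorm (unitaryChannel (NormedSpace.exp ((1 / 4 : ℂ) • majoranaQuad B))
        - unitaryChannel (piAct (polarSO M))) ≤ ENNReal.ofReal ε := by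
  refine (diamondNorm_sub_piAct_le hB hQ).trans (ENNReal.ofReal_le_ofReal ?_)
  have hd' : (0 : ℝ) < d := Nat.cast_pos.2 hd
  have h1 := hpol.frobSq_sub_orthogonal_le (exp_mem_orthogonalGroup hB)
  -- The `7` leaves room: `2d · 4 · ε²/(7d) = (8/7)ε²`, `√(8/7) ≤ 8/7`, and `(π/4)(8/7) < 1`.
  have h2 : frobSq (NormedSpace.exp B - polarSO M) ≤ 4 * (ε ^ 2 / (7 * d)) := by linarith
  have h3 : 2 * d * frobSq (NormedSpace.exp B - polarSO M) ≤ 8 / 7 * ε ^ 2 := by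
    calc 2 * d * frobSq (NormedSpace.exp B - polarSO M)
        ≤ 2 * d * (4 * (ε ^ 2 / (7 * d))) := by gcongr
      _ = 8 / 7 * ε ^ 2 := by field_simp; norm_num
  have h4 : √(2 * d) * √(frobSq (NormedSpace.exp B - polarSO M)) ≤ 8 / 7 * ε := by
    rw [← Real.sqrt_mul (by positivity)]
    refine Real.sqrt_le_iff.2 ⟨by positivity, h3.trans ?_⟩
    nlinarith [sq_nonneg ε]
  have hpi := Real.pi_lt_d2
  have hpi0 := Real.pi_pos
  calc √(2 * d) * (Real.pi / 4 * √(frobSq (NormedSpace.exp B - polarSO M)))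
      = Real.pi / 4 * (√(2 * d) * √(frobSq (NormedSpace.exp B - polarSO M))) := by ring
    _ ≤ Real.pi / 4 * (8 / 7 * ε) := by gcongr
    _ ≤ ε := by nlinarith


/-! ### Exponential moments of squares of sub-Gaussian variables -/

theorem lintegral_exp_sq_div_four_gaussianReal :
    ∫⁻ g, ENNReal.ofReal (Real.exp (g ^ 2 / 4)) ∂(gaussianReal 0 1) = ENNReal.ofReal (√2) := by
  rw [gaussianReal_of_var_ne_zero 0 one_ne_zero,
    lintegral_withDensity_eq_lintegral_mul _ (measurable_gaussianPDF 0 1) (by fun_prop)]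
  have e : ∀ g : ℝ, (gaussianPDF 0 1 * fun g => ENNReal.ofReal (Real.exp (g ^ 2 / 4))) g
      = ENNReal.ofReal ((√(2 * Real.pi))⁻¹ * Real.exp (-(1 / 4) * g ^ 2)) := by
    intro g
    rw [Pi.mul_apply, gaussianPDF, ← ENNReal.ofReal_mul (gaussianPDFReal_nonneg 0 1 g),
      gaussianPDFReal, mul_assoc, ← Real.exp_add]
    simp only [NNReal.coe_one, mul_one, sub_zero]
    congr 3
    ring
  rw [lintegral_congr e, ← ofReal_integral_eq_lintegral_ofReal
    ((integrable_exp_neg_mul_sq (by norm_num)).const_mul _)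
    (ae_of_all _ fun g => by positivity), integral_const_mul, integral_gaussian]
  congr 1
  have h : Real.pi / (1 / 4) = 2 * (2 * Real.pi) := by ring
  have hp : 0 < √(2 * Real.pi) := Real.sqrt_pos.2 (by positivity)
  rw [h, Real.sqrt_mul zero_le_two (2 * Real.pi), mul_comm (√2), inv_mul_cancel_left₀ hp.ne']

/-- Linearize the square: `exp(x²/(4c))` is the mean of `exp(g x/√(2c))` over a standard Gaussian
`g`. After exchanging integrals, the sub-Gaussian bound leaves the mean of `exp(g²/4)`, which is
`√2`. -/
theorem lintegral_exp_sq_le_of_hasSubgaussianMGF {Ω : Type*} [MeasurableSpace Ω] {P : Measure Ω}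
    [IsProbabilityMeasure P] {X : Ω → ℝ} (hX : Measurable X) {c : NNReal} (hc : 0 < c)
    (h : HasSubgaussianMGF X c P) :
    ∫⁻ ω, ENNReal.ofReal (Real.exp (X ω ^ 2 / (4 * c))) ∂P ≤ ENNReal.ofReal (√2) := by
  have hc' : (0 : ℝ) < c := hc
  have hs : √(2 * (c : ℝ)) ^ 2 = 2 * c := Real.sq_sqrt (by positivity)
  have hs0 : √(2 * (c : ℝ)) ≠ 0 := (Real.sqrt_pos.2 (by positivity)).ne'
  have e : ∀ x : ℝ, ENNReal.ofReal (Real.exp (x ^ 2 / (4 * c)))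
      = ∫⁻ g, ENNReal.ofReal (Real.exp (g / √(2 * (c : ℝ)) * x)) ∂(gaussianReal 0 1) := by
    intro x
    have h1 : ∀ g : ℝ, g / √(2 * (c : ℝ)) * x = (x / √(2 * (c : ℝ))) * g := fun g => by ring
    simp only [h1]
    rw [← ofReal_integral_eq_lintegral_ofReal (integrable_exp_mul_gaussianReal _)
      (ae_of_all _ fun g => (Real.exp_pos _).le)]
    have h2 := congr_fun (mgf_id_gaussianReal (μ := 0) (v := 1)) (x / √(2 * (c : ℝ)))
    rw [mgf] at h2
    simp only [id_eq] at h2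
    rw [h2]
    congr 2
    rw [div_pow, hs]
    push_cast
    field_simp
    ring
  simp only [e]
  rw [lintegral_lintegral_swap (by fun_prop), ← lintegral_exp_sq_div_four_gaussianReal]
  refine lintegral_mono fun g => ?_
  rw [← ofReal_integral_eq_lintegral_ofReal (h.integrable_exp_mul _)
    (ae_of_all _ fun g => (Real.exp_pos _).le)]
  refine ENNReal.ofReal_le_ofReal ((h.mgf_le (g / √(2 * (c : ℝ)))).trans (le_of_eq ?_))
  rw [div_pow, hs]
  congr 1
  field_simp
  ring

/-- Sums over disjoint blocks of an independent family are independent, so the factors split off one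
at a time. -/
theorem lintegral_prod_sum_of_iIndepFun {Ω κ ι : Type*} [MeasurableSpace Ω] [Fintype κ]
    {P : Measure Ω} {X : κ × ι → Ω → ℝ} (hX : iIndepFun X P) (hmeas : ∀ i, Measurable (X i))
    {φ : ℝ → ℝ≥0∞} (hφ : Measurable φ) (s : Finset ι) :
    ∫⁻ ω, ∏ z ∈ s, φ (∑ k, X (k, z) ω) ∂P = ∏ z ∈ s, ∫⁻ ω, φ (∑ k, X (k, z) ω) ∂P := by
  classical
  have : IsProbabilityMeasure P := hX.isProbabilityMeasure
  have hm : ∀ z, Measurable fun ω => φ (∑ k, X (k, z) ω) := fun z =>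
    hφ.comp (Finset.measurable_sum _ fun k _ => hmeas (k, z))
  induction s using Finset.cons_induction with
  | empty => simp
  | cons j s hj ih =>
    simp only [Finset.prod_cons]
    rw [← ih]
    refine lintegral_mul_eq_lintegral_mul_lintegral_of_indepFun (hm j)
      (Finset.measurable_prod _ fun z _ => hm z) ?_
    have hdisj : Disjoint ((Finset.univ : Finset κ) ×ˢ ({j} : Finset ι)) (Finset.univ ×ˢ s) := by
      rw [Finset.disjoint_product]
      exact Or.inr (Finset.disjoint_singleton_left.2 hj)
    have hind := hX.indepFun_finset _ _ hdisj hmeas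
    let f : (((Finset.univ : Finset κ) ×ˢ ({j} : Finset ι) : Finset (κ × ι)) → ℝ) → ℝ≥0∞ :=
      fun u => φ (∑ k, u ⟨(k, j), by simp⟩)
    let g : (((Finset.univ : Finset κ) ×ˢ s : Finset (κ × ι)) → ℝ) → ℝ≥0∞ :=
      fun u => ∏ z : s, φ (∑ k, u ⟨(k, z), by simp⟩)
    have hf : Measurable f := hφ.comp (Finset.measurable_sum _ fun k _ => measurable_pi_apply _)
    have hg : Measurable g := Finset.measurable_prod _ fun z _ =>
      hφ.comp (Finset.measurable_sum _ fun k _ => measurable_pi_apply _)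
    have := hind.comp hf hg
    have hge : (fun ω => ∏ z ∈ s, φ (∑ k, X (k, z) ω))
        = g ∘ fun ω (i : ((Finset.univ : Finset κ) ×ˢ s : Finset (κ × ι))) => X i ω := by
      funext ω
      exact (Finset.prod_coe_sort s fun z => φ (∑ k, X (k, z) ω)).symm
    rw [hge]
    exact this

/-! ### The law of the data -/

section Data

variable {r : ℕ}

/-- Heisenberg picture: `V† m_y V = ∑_i O_yi m_i`, and the input state `ρ_x` picks out the
coefficient `i = x`. -/
theorem outcomeProb_eq {B : MajMat d} (hB : Bᵀ = -B) (y x : MajIdx d) (s : ℝ) :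
    outcomeProb (NormedSpace.exp ((1 / 4 : ℂ) • majoranaQuad B)) y x s
      = (1 + s * NormedSpace.exp B y x) / 2 := by
  set V := NormedSpace.exp ((1 / 4 : ℂ) • majoranaQuad B)
  set O := NormedSpace.exp B
  have hVu : V ∈ unitary (QOp d) := exp_majoranaQuad_mem_unitary hB
  have hVV : Vᴴ * V = 1 := Unitary.star_mul_self_of_mem hVu
  have hO : O * Oᵀ = 1 := (Matrix.mem_orthogonalGroup_iff _ ℝ).1 (exp_mem_orthogonalGroup hB)
  have h1 : majorana y * V = V * majoranaVec (Oᵀ *ᵥ Pi.single y 1) := by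
    rw [exp_majoranaQuad_mul_majoranaVec hB, Matrix.mulVec_mulVec, hO, Matrix.one_mulVec,
      majoranaVec_single]
  have h2 : Matrix.trace (V * inputState x * Vᴴ) = 1 := by
    rw [Matrix.trace_mul_comm, ← Matrix.mul_assoc, hVV, Matrix.one_mul, trace_inputState]
  have h3 : Matrix.trace (majorana y * (V * inputState x * Vᴴ)) = (O y x : ℂ) := by
    have e : majorana y * (V * inputState x * Vᴴ)
        = V * (majoranaVec (Oᵀ *ᵥ Pi.single y 1) * inputState x * Vᴴ) := by
      rw [← Matrix.mul_assoc, ← Matrix.mul_assoc, h1]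
      simp only [Matrix.mul_assoc]
    rw [e, Matrix.trace_mul_comm, Matrix.mul_assoc, hVV, Matrix.mul_one, majoranaVec,
      Finset.sum_mul, Matrix.trace_sum]
    simp [trace_majorana_mul_inputState]
  rw [outcomeProb, Matrix.smul_mul, Matrix.add_mul, Matrix.one_mul, Matrix.smul_mul,
    Matrix.trace_smul, Matrix.trace_add, Matrix.trace_smul, h2, h3]
  have : (1 / 2 : ℂ) • ((1 : ℂ) + (s : ℂ) • (O y x : ℂ)) = (((1 + s * O y x) / 2 : ℝ) : ℂ) := by
    simp only [smul_eq_mul]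
    push_cast
    ring
  rw [this, Complex.ofReal_re]

theorem frobSq_sampleMean_sub {Ω : Type*} {m : Fin r → MajIdx d → MajIdx d → Ω → ℝ}
    (hr : 0 < r) (O : MajMat d) (ω : Ω) :
    frobSq (sampleMean m ω - O)
      = ∑ z : MajIdx d × MajIdx d, (∑ k, (m k z.1 z.2 ω - O z.1 z.2)) ^ 2 / (r : ℝ) ^ 2 := by
  have hr' : (r : ℝ) ≠ 0 := Nat.cast_ne_zero.2 hr.ne'
  rw [Fintype.sum_prod_type, frobSq]
  refine Finset.sum_congr rfl fun y _ => Finset.sum_congr rfl fun x _ => ?_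
  rw [← div_pow]
  congr 1
  simp only [sampleMean, Matrix.sub_apply, Matrix.smul_apply, Matrix.sum_apply, Matrix.of_apply,
    smul_eq_mul, Finset.sum_sub_distrib, Finset.sum_const, Finset.card_univ, Fintype.card_fin,
    nsmul_eq_mul]
  field_simp

theorem IsTomographyData.measurable_frobSq_sampleMean_sub
    {Ω : Type*} [MeasurableSpace Ω] {P : Measure Ω} {m : Fin r → MajIdx d → MajIdx d → Ω → ℝ}
    {V : QOp d} (hm : IsTomographyData P V m) (hr : 0 < r) (O : MajMat d) :
    Measurable fun ω => frobSq (sampleMean m ω - O) := by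
  simp only [frobSq_sampleMean_sub hr]
  refine Finset.measurable_sum _ fun z _ => Measurable.div_const (Measurable.pow_const ?_ 2) _
  exact Finset.measurable_sum _ fun k _ => (hm.measurable k z.1 z.2).sub_const _

variable {Ω : Type*} [MeasurableSpace Ω] {P : Measure Ω} [IsProbabilityMeasure P]
  {m : Fin r → MajIdx d → MajIdx d → Ω → ℝ} {B : MajMat d}

theorem IsTomographyData.integral_eq (hB : Bᵀ = -B)
    (hm : IsTomographyData P (NormedSpace.exp ((1 / 4 : ℂ) • majoranaQuad B)) m)
    (k : Fin r) (y x : MajIdx d) : ∫ ω, m k y x ω ∂P = NormedSpace.exp B y x := by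
  have hset : MeasurableSet {ω | m k y x ω = 1} :=
    hm.measurable k y x (measurableSet_singleton 1)
  have e : ∀ ω, m k y x ω = 2 * Set.indicator {ω | m k y x ω = 1} (fun _ => (1 : ℝ)) ω - 1 := by
    intro ω
    rcases hm.outcome k y x ω with h | h
    · rw [Set.indicator_of_mem (show ω ∈ {ω | m k y x ω = 1} from h), h]
      norm_num
    · have h' : ω ∉ {ω | m k y x ω = 1} := fun h' => by
        have h1 : m k y x ω = 1 := h'
        rw [h] at h1
        norm_num at h1
      rw [Set.indicator_of_notMem h', h]
      norm_num
  rw [integral_congr_ae (ae_of_all _ e), integral_sub _ (integrable_const _), integral_const_mul,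
    integral_indicator_const _ hset, hm.born k y x 1 (Or.inl rfl), outcomeProb_eq hB]
  · simp
    ring
  · exact (Integrable.indicator (integrable_const _) hset).const_mul _

theorem IsTomographyData.hasSubgaussianMGF_sum (hB : Bᵀ = -B)
    (hm : IsTomographyData P (NormedSpace.exp ((1 / 4 : ℂ) • majoranaQuad B)) m)
    (y x : MajIdx d) :
    HasSubgaussianMGF (fun ω => ∑ k, (m k y x ω - NormedSpace.exp B y x)) r P := by
  have hsub : ∀ k, HasSubgaussianMGF (fun ω => m k y x ω - NormedSpace.exp B y x) 1 P := by
    intro k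
    have h := hasSubgaussianMGF_of_mem_Icc (a := -1) (b := 1) (hm.measurable k y x).aemeasurable
      (ae_of_all P fun ω => by rcases hm.outcome k y x ω with h | h <;> rw [h] <;> norm_num)
    rw [hm.integral_eq hB] at h
    -- Hoeffding's lemma on the interval `[-1, 1]` of length `2` gives parameter `(2/2)² = 1` per
    -- outcome, hence `r` for the sum.
    have hc : ((‖(1 : ℝ) - -1‖₊ / 2) ^ 2 : NNReal) = 1 := by
      ext
      norm_num
    rwa [hc] at h
  have hind : iIndepFun (fun k ω => m k y x ω - NormedSpace.exp B y x) P := by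
    have h1 := hm.indep.precomp (g := fun k : Fin r => (k, y, x))
      (fun a b hab => (Prod.mk.inj hab).1)
    exact h1.comp (fun _ t => t - NormedSpace.exp B y x) fun _ => by fun_prop
  have h := HasSubgaussianMGF.sum_of_iIndepFun hind (s := Finset.univ) fun k _ => hsub k
  simpa using h

theorem IsTomographyData.lintegral_exp_frobSq_le (hB : Bᵀ = -B) (hr : 0 < r)
    (hm : IsTomographyData P (NormedSpace.exp ((1 / 4 : ℂ) • majoranaQuad B)) m) :
    ∫⁻ ω, ENNReal.ofReal (Real.exp (r / 4 * frobSq (sampleMean m ω - NormedSpace.exp B))) ∂P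
      ≤ ENNReal.ofReal (4 ^ d ^ 2) := by
  set O := NormedSpace.exp B
  have hr' : (r : ℝ) ≠ 0 := Nat.cast_ne_zero.2 hr.ne'
  have hX : iIndepFun (fun (i : Fin r × MajIdx d × MajIdx d) ω =>
      m i.1 i.2.1 i.2.2 ω - O i.2.1 i.2.2) P :=
    hm.indep.comp (fun i t => t - O i.2.1 i.2.2) fun _ => by fun_prop
  have hφ : Measurable fun t : ℝ =>
      ENNReal.ofReal (Real.exp (t ^ 2 / (4 * (r : NNReal)))) := by fun_prop
  have h := lintegral_prod_sum_of_iIndepFun hX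
    (fun i => (hm.measurable i.1 i.2.1 i.2.2).sub_const _) hφ Finset.univ
  have e : ∀ ω, ENNReal.ofReal (Real.exp (r / 4 * frobSq (sampleMean m ω - O)))
      = ∏ z : MajIdx d × MajIdx d, ENNReal.ofReal (Real.exp
          ((∑ k, (m k z.1 z.2 ω - O z.1 z.2)) ^ 2 / (4 * (r : NNReal)))) := by
    intro ω
    rw [← ENNReal.ofReal_prod_of_nonneg fun _ _ => (Real.exp_pos _).le, ← Real.exp_sum,
      frobSq_sampleMean_sub hr, Finset.mul_sum]
    congr 2
    refine Finset.sum_congr rfl fun z _ => ?_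
    push_cast
    field_simp
  rw [lintegral_congr e]
  refine h.le.trans ?_
  calc _ ≤ ∏ _z : MajIdx d × MajIdx d, ENNReal.ofReal (√2) :=
        Finset.prod_le_prod' fun z _ => lintegral_exp_sq_le_of_hasSubgaussianMGF
          (Finset.measurable_sum _ fun k _ => (hm.measurable k z.1 z.2).sub_const _)
          (by exact_mod_cast hr) (hm.hasSubgaussianMGF_sum hB z.1 z.2)
    _ = ENNReal.ofReal (4 ^ d ^ 2) := by
        rw [Finset.prod_const, ← ENNReal.ofReal_pow (Real.sqrt_nonneg _), Finset.card_univ]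
        congr 1
        have hc : Fintype.card (MajIdx d × MajIdx d) = 2 * (2 * d ^ 2) := by
          simp only [Fintype.card_prod, Fintype.card_fin]
          ring
        rw [hc, pow_mul, Real.sq_sqrt zero_le_two, pow_mul]
        norm_num

/-- With probability at least `1 - δ`, the sample mean is close to the matrix of means. -/
theorem IsTomographyData.one_sub_le_prob (hB : Bᵀ = -B) (hd : 0 < d) (hr : 0 < r)
    (hm : IsTomographyData P (NormedSpace.exp ((1 / 4 : ℂ) • majoranaQuad B)) m)
    {ε δ : ℝ} (hε : 0 < ε) (hδ₀ : 0 < δ) (hδ₁ : δ < 1)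
    (hrε : 28 * (d : ℝ) ^ 3 / ε ^ 2 * Real.log (4 * (d : ℝ) / δ) ≤ (r : ℝ)) :
    1 - δ ≤ P.real {ω | frobSq (sampleMean m ω - NormedSpace.exp B) ≤ ε ^ 2 / (7 * d)} := by
  set O := NormedSpace.exp B
  have hd' : (1 : ℝ) ≤ d := by exact_mod_cast hd
  have hd0 : (0 : ℝ) < d := by linarith
  have hmeas := hm.measurable_frobSq_sampleMean_sub hr O
  set T : ℝ := r / 4 * (ε ^ 2 / (7 * d)) with hT
  -- The sample size gives `T ≥ d² log(4d/δ)`; the terms `d² log d ≥ 0` and `(d² - 1)(-log δ) ≥ 0`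
  -- are discarded.
  have hTlog : d ^ 2 * Real.log 4 - Real.log δ ≤ T := by
    have h1 : Real.log (4 * (d : ℝ) / δ) = Real.log 4 + Real.log d - Real.log δ := by
      rw [Real.log_div (by positivity) hδ₀.ne', Real.log_mul (by norm_num) hd0.ne']
    have h2 : 0 ≤ Real.log d := Real.log_nonneg hd'
    have h3 : Real.log δ < 0 := Real.log_neg hδ₀ hδ₁
    have h4 : (d : ℝ) ^ 2 * Real.log (4 * d / δ) ≤ T := by
      calc (d : ℝ) ^ 2 * Real.log (4 * d / δ)
          = (28 * (d : ℝ) ^ 3 / ε ^ 2 * Real.log (4 * (d : ℝ) / δ)) / 4 * (ε ^ 2 / (7 * d)) := by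
            field_simp
            ring
        _ ≤ T := by rw [hT]; gcongr
    rw [h1] at h4
    have h5 : (1 : ℝ) ≤ (d : ℝ) ^ 2 := one_le_pow₀ hd'
    nlinarith
  set G : Set Ω := {ω | frobSq (sampleMean m ω - O) ≤ ε ^ 2 / (7 * d)} with hG
  have hGm : MeasurableSet G := measurableSet_le hmeas measurable_const
  have hbad : P Gᶜ ≤ ENNReal.ofReal δ := by
    have hsub : Gᶜ ⊆ {ω | ENNReal.ofReal (Real.exp T)
        ≤ ENNReal.ofReal (Real.exp (r / 4 * frobSq (sampleMean m ω - O)))} := by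
      intro ω hω
      have hω' : ε ^ 2 / (7 * d) < frobSq (sampleMean m ω - O) := not_le.1 hω
      refine ENNReal.ofReal_le_ofReal (Real.exp_le_exp.2 ?_)
      rw [hT]
      gcongr
    refine (measure_mono hsub).trans ?_
    -- Markov's inequality for the exponential moment.
    refine (meas_ge_le_lintegral_div
      (hmeas.const_mul _).exp.ennreal_ofReal.aemeasurable (by simp [Real.exp_pos])
      ENNReal.ofReal_ne_top).trans ?_
    refine (ENNReal.div_le_div_right (hm.lintegral_exp_frobSq_le hB hr) _).trans ?_
    rw [← ENNReal.ofReal_div_of_pos (Real.exp_pos T)]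
    refine ENNReal.ofReal_le_ofReal ?_
    rw [div_le_iff₀ (Real.exp_pos T)]
    calc (4 : ℝ) ^ d ^ 2 = δ * Real.exp (d ^ 2 * Real.log 4 - Real.log δ) := by
          rw [Real.exp_sub, Real.exp_log hδ₀, mul_div_cancel₀ _ hδ₀.ne', mul_comm,
            Real.exp_mul, Real.exp_log (by norm_num)]
          exact_mod_cast (Real.rpow_natCast 4 (d ^ 2)).symm
      _ ≤ δ * Real.exp T := by gcongr
  have hbad' : P.real Gᶜ ≤ δ := ENNReal.toReal_le_of_le_ofReal hδ₀.le hbad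
  rw [probReal_compl_eq_one_sub hGm] at hbad'
  linarith

end Data

end FLOTomography

/-! ### The tomography guarantee -/

theorem theorem7 {d r : ℕ} (hd : 0 < d) {V : FLOTomography.QOp d}
    (hV : FLOTomography.IsActiveFLO V)
    {Ω : Type*} [MeasurableSpace Ω] (P : MeasureTheory.Measure Ω)
    [MeasureTheory.IsProbabilityMeasure P]
    (m : Fin r → FLOTomography.MajIdx d → FLOTomography.MajIdx d → Ω → ℝ)
    (hm : FLOTomography.IsTomographyData P V m)
    (ε δ : ℝ) (hε : 0 < ε) (hδ₀ : 0 < δ) (hδ₁ : δ < 1)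
    (hr : 28 * (d : ℝ) ^ 3 / ε ^ 2 * Real.log (4 * (d : ℝ) / δ) ≤ (r : ℝ)) :
    -- the estimate is `ε`-close with probability at least `1 - δ`
    1 - δ ≤ P.real {ω | FLOTomography.diamondNorm
        (FLOTomography.unitaryChannel V
          - FLOTomography.unitaryChannel (FLOTomography.estimator m ω)) ≤ ENNReal.ofReal ε} ∧
    -- and, unless `ε` exceeds the trivial bound `2`, the same holds jointly with the event that
    -- the sample mean has exactly one orthogonal polar factor and that it lies in `SO(2d)`
    (ε ≤ 2 → 1 - δ ≤ P.real {ω |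
      (∃ Q ∈ FLOTomography.SO d, ∀ Q' : FLOTomography.MajMat d,
        FLOTomography.IsPolarFactor (FLOTomography.sampleMean m ω) Q' ↔ Q' = Q) ∧
      FLOTomography.diamondNorm
        (FLOTomography.unitaryChannel V
          - FLOTomography.unitaryChannel (FLOTomography.estimator m ω)) ≤ ENNReal.ofReal ε}) := by
  obtain ⟨B, hB, rfl⟩ := hV.exists_eq_exp
  have hd1 : (1 : ℝ) ≤ d := by exact_mod_cast hd
  have hr0 : 0 < r := by
    have hlog : 0 < Real.log (4 * (d : ℝ) / δ) :=
      Real.log_pos ((one_lt_div hδ₀).2 (by linarith))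
    have : (0 : ℝ) < r := lt_of_lt_of_le (by positivity) hr
    exact_mod_cast this
  have hjoint : ε ≤ 2 → 1 - δ ≤ P.real {ω |
      (∃ Q ∈ FLOTomography.SO d, ∀ Q' : FLOTomography.MajMat d,
        FLOTomography.IsPolarFactor (FLOTomography.sampleMean m ω) Q' ↔ Q' = Q) ∧
      FLOTomography.diamondNorm
        (FLOTomography.unitaryChannel
            (NormedSpace.exp ((1 / 4 : ℂ) • FLOTomography.majoranaQuad B))
          - FLOTomography.unitaryChannel (FLOTomography.estimator m ω)) ≤ ENNReal.ofReal ε} := by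
    intro hε2
    refine (hm.one_sub_le_prob hB hd hr0 hε hδ₀ hδ₁ hr).trans (measureReal_mono ?_)
    intro ω hω
    have hω' : FLOTomography.frobSq (FLOTomography.sampleMean m ω - NormedSpace.exp B)
        ≤ ε ^ 2 / (7 * d) := hω
    -- Here `ε ≤ 2` enters: `ε²/(7d) ≤ 4/7`.
    have hlt : FLOTomography.frobSq (FLOTomography.sampleMean m ω - NormedSpace.exp B) < 1 := by
      refine lt_of_le_of_lt hω' ((div_lt_one (by positivity)).2 ?_)
      nlinarith
    obtain ⟨Q, hQ, hQu⟩ := FLOTomography.exists_unique_isPolarFactor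
      (FLOTomography.det_pos_of_frobSq_sub_lt_one (FLOTomography.exp_mem_SO hB) hlt)
    have hpQ := FLOTomography.polarSO_eq hQ hQu
    refine ⟨⟨Q, hQ, hQu⟩, FLOTomography.diamondNorm_sub_polarSO_le hd hB hε ?_ ?_ hω'⟩
    · rwa [hpQ]
    · exact (hQu _).2 hpQ
  refine ⟨?_, hjoint⟩
  rcases le_or_gt ε 2 with hε2 | hε2
  · exact (hjoint hε2).trans (measureReal_mono fun ω hω => hω.2)
  -- Beyond `2` every outcome succeeds, because `piAct` is unitary whatever matrix it receives.
  · have huniv : {ω | FLOTomography.diamondNorm (FLOTomography.unitaryChannel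
          (NormedSpace.exp ((1 / 4 : ℂ) • FLOTomography.majoranaQuad B))
          - FLOTomography.unitaryChannel (FLOTomography.estimator m ω)) ≤ ENNReal.ofReal ε}
        = Set.univ := Set.eq_univ_of_forall fun ω =>
      (FLOTomography.diamondNorm_sub_piAct_le_two
        (FLOTomography.exp_majoranaQuad_mem_unitary hB) _).trans
        (ENNReal.ofReal_le_ofReal hε2.le)
    rw [huniv, probReal_univ]
    linarith
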